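/- Setting. Let $g\ge 2$, $n=8g-4$, indices mod $n$. Put $\sigma(i)=4g-i$ for $i$ odd, $\sigma(i)=2-i$ for $i$ even, $\rho(i)=\sigma(i)+1$, $\tau(i)=i+4g-2$. Let $M=\Gamma\backslash\mathbb D$ be a closed oriented hyperbolic surface of genus $g$, with $\Gamma$ acting freely on the unit disk $\mathbb D$, and let $\mathcal F$ be a fundamental $n$-gon for $\Gamma$ with sides $1,\dots,n$ and vertices $V_1,\dots,V_n$, both in counterclockwise order, where side $i$ joins $V_i$ to $V_{i+1}$ and lies on the complete geodesic from $P_i$ to $Q_{i+1}$. Suppose that the points $P_1,Q_1,P_2,Q_2,\dots,P_n,Q_n$ of the unit circle $\mathbb S$ are distinct and in this counterclockwise order; that $\Gamma$ is generated by Möbius transformations $T_1,\dots,T_n$ of $\mathbb D$ with $T_i(V_i)=V_{\rho(i)}$, $T_{\sigma(i)}T_i=\mathrm{Id}$ and $T_{\rho^3(i)}T_{\rho^2(i)}T_{\rho(i)}T_i=\mathrm{Id}$; and that the geodesics $P_iQ_{i+1}$ never meet the interior of a translate $\gamma\mathcal F$, $\gamma\in\Gamma$ (extension condition). Arcs $[a,b]$,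 $[a,b)$ of $\mathbb S$ run counterclockwise. For parameters $\bar A=\{A_1,\dots,A_n\}$ with $A_i\in[P_i,Q_i]$ let $F_{\bar A}(u,w)=(T_iu,T_iw)$ if $w\in[A_i,A_{i+1})$. If $\bar A$ is extremal, i.e. $A_i\in\{P_i,Q_i\}$ for all $i$, let $$\Omega_{\bar A}=\bigcup_{i=1}^{n}\,[H_{i+1},G_{i-2}]\times[P_i,Q_i]\ \cup\ [H_{i+1},G_{i-1}]\times[Q_i,P_{i+1}],$$ where $G_1,\dots,G_n$ is the (unique) solution of $G_i\in[P_i,P_{i+1}]$, $G_{\sigma(i)}=T_iG_{i-2}$ if $A_i=P_i$, $G_{\sigma(i)}=T_{\tau(i)+1}G_{\tau(i)}$ if $A_i=Q_i$, and $H_i=T_{\sigma(i)}T_{\tau(i)-1}G_{\tau(i)-1}$. For a set $\Omega\subset\mathbb S\times\mathbb S$ let $\Omega^-$ be $\Omega$ without its upper horizontal edges, i.e. the set of $(u,w)\in\Omega$ with $\{u\}\times[w,x)\subset\Omega$ for some $x\ne w$. Call $\Omega$ a *bijectivity domain with finite rectangular structure* of $F_{\bar A}$ if $\Omega$ is a non-empty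 finite union of products of two closed nondegenerate arcs, $F_{\bar A}(\Omega^-)=\Omega^-$, and for some finite set $E\subset\mathbb S$ the map $F_{\bar A}$ is injective on $\{p\in\Omega^-: F_{\bar A}(p)\notin E\times\mathbb S\}$. Let $\phi(x,y)=(y,x)$. Parameters $\bar D$ are *dual* to $\bar A$ (with respect to $\Omega_{\bar A},\Omega_{\bar D}$) if $\Omega_{\bar A}$ and $\Omega_{\bar D}$ are bijectivity domains with finite rectangular structure of $F_{\bar A}$ and $F_{\bar D}$, $\phi(\Omega_{\bar A})=\Omega_{\bar D}$, and every $p=(u,w)\in\Omega_{\bar A}^-$ with $u\notin\bar D$ has exactly one preimage $F_{\bar A}^{-1}(p)$ in $\Omega_{\bar A}^-$, which satisfies $\phi(F_{\bar A}^{-1}(p))=F_{\bar D}(\phi(p))$. Proposition. For every $g\ge 2$ and every such $\Gamma$, $\mathcal F$, $T_1,\dots,T_n$: a) $\bar P=\{P_1,P_2,\dots\}$ and $\bar Q=\{Q_1,Q_2,\dots\}$ are dual to each other (each is dual to the other); b) $\{P_1,Q_2,P_3,Q_4,\dots\}$ and $\{Q_1,P_2,Q_3,P_4,\dots\}$ are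 dual to each other; c) $\{P_1,P_2,Q_3,Q_4,P_5,P_6,Q_7,Q_8,\dots\}$ (that is, $A_i=P_i$ if $i\equiv1,2$ and $A_i=Q_i$ if $i\equiv3,0 \bmod 4$) is dual to itself; d) $\{Q_1,Q_2,P_3,P_4,Q_5,Q_6,P_7,P_8,\dots\}$ (that is, $A_i=Q_i$ if $i\equiv1,2$ and $A_i=P_i$ if $i\equiv3,0\bmod 4$) is dual to itself. -/

import Mathlib

open ComplexConjugate

noncomputable section

/-! ### Orientation-preserving isometries of the disk model -/

/-- `SU(1,1)`: the matrices `!![a, b; conj b, conj a]` of determinant `1`. -/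
def SU11 : Subgroup (Matrix.SpecialLinearGroup (Fin 2) ℂ) where
  carrier := {M | M 1 1 = conj (M 0 0) ∧ M 1 0 = conj (M 0 1)}
  one_mem' := by simp
  mul_mem' := by
    rintro M N ⟨hM, hM'⟩ ⟨hN, hN'⟩
    constructor <;>
      simp only [Matrix.SpecialLinearGroup.coe_mul, Matrix.mul_apply,
        Fin.sum_univ_two, map_add, map_mul, hM, hM', hN, hN', Complex.conj_conj] <;> ring
  inv_mem' := by
    rintro M ⟨hM, hM'⟩
    constructor <;> simp [Matrix.SpecialLinearGroup.SL2_inv_expl, hM, hM']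

namespace SU11

/-- The Möbius transformation `z ↦ (a z + b) / (conj b z + conj a)`. -/
def moebius (M : SU11) (z : ℂ) : ℂ :=
  (M.1 0 0 * z + M.1 0 1) / (M.1 1 0 * z + M.1 1 1)

theorem normSq_sub (M : SU11) (z : ℂ) :
    Complex.normSq (M.1 1 0 * z + M.1 1 1) - Complex.normSq (M.1 0 0 * z + M.1 0 1)
      = 1 - Complex.normSq z := by
  obtain ⟨⟨M, hdet⟩, h1, h2⟩ := M
  replace h1 : M 1 1 = conj (M 0 0) := h1
  replace h2 : M 1 0 = conj (M 0 1) := h2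
  rw [Matrix.det_fin_two, h1, h2, Complex.mul_conj, Complex.mul_conj] at hdet
  have hd : Complex.normSq (M 0 0) - Complex.normSq (M 0 1) = 1 := by exact_mod_cast hdet
  change Complex.normSq (M 1 0 * z + M 1 1) - Complex.normSq (M 0 0 * z + M 0 1)
    = 1 - Complex.normSq z
  rw [h1, h2]
  simp only [Complex.normSq_apply, Complex.add_re, Complex.add_im, Complex.mul_re,
    Complex.mul_im, Complex.conj_re, Complex.conj_im] at hd ⊢
  linear_combination (1 - z.re * z.re - z.im * z.im) * hd

theorem denom_ne_zero (M : SU11) {z : ℂ} (hz : Complex.normSq z ≤ 1) :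
    M.1 1 0 * z + M.1 1 1 ≠ 0 := by
  intro h
  have h1 := normSq_sub M z
  rw [h, map_zero] at h1
  have h2 : M.1 0 0 * z + M.1 0 1 = 0 := by
    rw [← Complex.normSq_eq_zero]
    linarith [Complex.normSq_nonneg (M.1 0 0 * z + M.1 0 1)]
  have hdet := M.1.2
  rw [Matrix.det_fin_two] at hdet
  exact one_ne_zero (α := ℂ) (by linear_combination M.1 0 0 * h - M.1 1 0 * h2 - hdet)

theorem moebius_one (z : ℂ) : moebius 1 z = z := by
  simp [moebius]

theorem moebius_mul (M N : SU11) {z : ℂ} (hz : Complex.normSq z ≤ 1) :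
    moebius (M * N) z = moebius M (moebius N z) := by
  have h := denom_ne_zero N hz
  have e1 : M.1 0 0 * moebius N z + M.1 0 1
      = ((M * N).1 0 0 * z + (M * N).1 0 1) / (N.1 1 0 * z + N.1 1 1) := by
    rw [moebius, eq_div_iff h, add_mul, mul_assoc, div_mul_cancel₀ _ h]
    simp only [Subgroup.coe_mul, Matrix.SpecialLinearGroup.coe_mul, Matrix.mul_apply,
      Fin.sum_univ_two]
    ring
  have e2 : M.1 1 0 * moebius N z + M.1 1 1
      = ((M * N).1 1 0 * z + (M * N).1 1 1) / (N.1 1 0 * z + N.1 1 1) := by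
    rw [moebius, eq_div_iff h, add_mul, mul_assoc, div_mul_cancel₀ _ h]
    simp only [Subgroup.coe_mul, Matrix.SpecialLinearGroup.coe_mul, Matrix.mul_apply,
      Fin.sum_univ_two]
    ring
  rw [moebius, moebius, e1, e2, div_div_div_cancel_right₀ h]

theorem norm_moebius_lt (M : SU11) {z : ℂ} (hz : ‖z‖ < 1) : ‖moebius M z‖ < 1 := by
  have hz' : Complex.normSq z < 1 := by
    rw [Complex.normSq_eq_norm_sq]; nlinarith [norm_nonneg z]
  have h := denom_ne_zero M hz'.le
  have h1 := normSq_sub M z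
  rw [moebius, norm_div, div_lt_one (norm_pos_iff.2 h),
    ← sq_lt_sq₀ (norm_nonneg _) (norm_nonneg _), ← Complex.normSq_eq_norm_sq,
    ← Complex.normSq_eq_norm_sq]
  linarith

theorem norm_moebius_eq (M : SU11) {z : ℂ} (hz : ‖z‖ = 1) : ‖moebius M z‖ = 1 := by
  have hz' : Complex.normSq z = 1 := by
    rw [Complex.normSq_eq_norm_sq, hz, one_pow]
  have h := denom_ne_zero M hz'.le
  have h1 := normSq_sub M z
  rw [moebius, norm_div, div_eq_one_iff_eq (norm_ne_zero_iff.2 h),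
    ← sq_eq_sq₀ (norm_nonneg _) (norm_nonneg _), ← Complex.normSq_eq_norm_sq,
    ← Complex.normSq_eq_norm_sq]
  linarith

/-- `SU(1,1)` acts on the unit disk by Möbius transformations. -/
instance : MulAction SU11 Complex.UnitDisc where
  smul M z := .mk (moebius M z) (norm_moebius_lt M z.norm_lt_one)
  one_smul z := Complex.UnitDisc.coe_injective (moebius_one z)
  mul_smul M N z := Complex.UnitDisc.coe_injective (moebius_mul M N z.normSq_lt_one.le)

/-- `SU(1,1)` acts on the unit circle by Möbius transformations. -/
instance : MulAction SU11 Circle where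
  smul M z := ⟨moebius M z, mem_sphere_zero_iff_norm.2 (norm_moebius_eq M z.norm_coe)⟩
  one_smul z := Circle.ext (moebius_one z)
  mul_smul M N z := Circle.ext (moebius_mul M N z.normSq_coe.le)

end SU11

namespace BowenSeries

open Complex (UnitDisc)

/-! ### Circle arcs and geodesics -/

/-- The points `a, b, c` of the unit circle are distinct and occur in this order when the circle
is traversed counterclockwise (that is, the triangle `abc` is positively oriented). -/
def Ccw (a b c : Circle) : Prop :=
  0 < (conj ((b : ℂ) - a) * ((c : ℂ) - a)).im

/-- The closed arc `[a, b]`, from `a` counterclockwise to `b`. It is `{a}` if `a = b`. -/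
def arc (a b : Circle) : Set Circle :=
  {x | x = a ∨ x = b ∨ Ccw a x b}

/-- The half-open arc `[a, b)`, from `a` counterclockwise to `b`, for `a ≠ b`. -/
def arcCO (a b : Circle) : Set Circle :=
  {x | (x = a ∧ a ≠ b) ∨ Ccw a x b}

/-- The equation of the geodesic from `a` to `b`: `geodesicSide a b z = 0` is the circle
orthogonal to the unit circle (or the line through `0`) that contains `a` and `b`, and in the unit
disk `geodesicSide a b z` is positive to the left of the geodesic from `a` to `b`. -/
def geodesicSide (a b : Circle) (z : ℂ) : ℝ :=
  (1 + Complex.normSq z) * (conj (a : ℂ) * b).im + 2 * (conj ((b : ℂ) - a) * z).im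

/-- The geodesic of the hyperbolic disk with endpoints `a ≠ b`. -/
def geodesic (a b : Circle) : Set UnitDisc :=
  {z | geodesicSide a b z = 0}

/-! ### The fundamental `(8g-4)`-gon -/

/-- Labels of the sides, modulo `8g-4`. -/
abbrev Index (g : ℕ) : Type := ZMod (8 * g - 4)

/-- The side pairing rule: `σ(i) = 4g - i` for odd `i` and `σ(i) = 2 - i` for even `i`. -/
def sigma {g : ℕ} (i : Index g) : Index g :=
  if Even i.val then 2 - i else (4 * g : ℕ) - i

/-- `ρ(i) = σ(i) + 1`. -/
def rho {g : ℕ} (i : Index g) : Index g := sigma i + 1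

/-- `τ(i) = i + 4g - 2`. -/
def tau {g : ℕ} (i : Index g) : Index g := i + (4 * g - 2 : ℕ)

/-- A fundamental `(8g-4)`-gon with the extension condition, for a surface `Γ \ 𝔻` of genus `g`.
The region bounded by the sides is a fundamental domain of the group `Γ` generated by the side
pairings; the `8g-4` vertices fall into `2g-1` cycles of length four, so that the Euler
characteristic of `Γ \ 𝔻` is `(2g-1) - (4g-2) + 1 = 2-2g`. -/
structure SurfacePolygon (g : ℕ) where
  /-- `P i` and `Q (i+1)` are the endpoints of the geodesic extending side `i`. -/
  P : Index g → Circle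
  Q : Index g → Circle
  /-- `V i` and `V (i+1)` are the vertices on side `i`. -/
  V : Index g → UnitDisc
  /-- The side pairing transformations. -/
  T : Index g → SU11
  /-- The points `P₁, Q₁, P₂, Q₂, …, Pₙ, Qₙ` with `n = 8g-4` are distinct and occur in this
  counterclockwise order. -/
  order : ∀ k l m : ℕ, k < l → l < m → m < 2 * (8 * g - 4) →
    Ccw (if Even k then P (k / 2 + 1 : ℕ) else Q (k / 2 + 1 : ℕ))
      (if Even l then P (l / 2 + 1 : ℕ) else Q (l / 2 + 1 : ℕ))
      (if Even m then P (m / 2 + 1 : ℕ) else Q (m / 2 + 1 : ℕ))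
  /-- Side `i` runs from `V i` to `V (i+1)` on the geodesic from `P i` to `Q (i+1)`. -/
  left_vertex_mem : ∀ i, V i ∈ geodesic (P i) (Q (i + 1))
  right_vertex_mem : ∀ i, V (i + 1) ∈ geodesic (P i) (Q (i + 1))
  /-- `T_i(V_i) = V_{ρ(i)}`. -/
  T_vertex : ∀ i, T i • V i = V (rho i)
  /-- `T_{σ(i)} T_i = Id`. -/
  T_sigma : ∀ i (z : UnitDisc), T (sigma i) • T i • z = z
  /-- `T_{ρ³(i)} T_{ρ²(i)} T_{ρ(i)} T_i = Id`. -/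
  T_cycle : ∀ i (z : UnitDisc),
    T (rho (rho (rho i))) • T (rho (rho i)) • T (rho i) • T i • z = z
  /-- `Γ` acts freely on the disk. -/
  free : ∀ γ ∈ Subgroup.closure (Set.range T), ∀ z : UnitDisc, γ • z = z →
    ∀ z' : UnitDisc, γ • z' = z'
  /-- The translates of the polygon cover the disk. -/
  covers : ∀ z : UnitDisc, ∃ γ ∈ Subgroup.closure (Set.range T),
    ∀ i, 0 ≤ geodesicSide (P i) (Q (i + 1)) (γ • z : UnitDisc)
  /-- The translates of the interior of the polygon are disjoint. -/
  interior_disjoint : ∀ γ ∈ Subgroup.closure (Set.range T), ∀ z : UnitDisc,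
    (∀ i, 0 < geodesicSide (P i) (Q (i + 1)) z) →
    (∀ i, 0 < geodesicSide (P i) (Q (i + 1)) (γ • z : UnitDisc)) →
    ∀ z' : UnitDisc, γ • z' = z'
  /-- Extension condition: the geodesics extending the sides do not meet the interior of any
  translate of the polygon. -/
  extension : ∀ γ ∈ Subgroup.closure (Set.range T), ∀ z : UnitDisc,
    (∀ i, 0 < geodesicSide (P i) (Q (i + 1)) z) →
    ∀ j, γ • z ∉ geodesic (P j) (Q (j + 1))

/-! ### Boundary maps, their natural extensions, and duality -/

/-- The finite unions of products of two closed nondegenerate arcs. -/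
def FiniteRectangular (Ω : Set (Circle × Circle)) : Prop :=
  ∃ R : Finset ((Circle × Circle) × (Circle × Circle)), R.Nonempty ∧
    (∀ r ∈ R, r.1.1 ≠ r.1.2 ∧ r.2.1 ≠ r.2.2) ∧
    Ω = ⋃ r ∈ R, arc r.1.1 r.1.2 ×ˢ arc r.2.1 r.2.2

/-- `Ω` without its upper horizontal edges: the points `(u, w) ∈ Ω` such that
`{u} × [w, x) ⊆ Ω` for some `x ≠ w`. -/
def lowerPart (Ω : Set (Circle × Circle)) : Set (Circle × Circle) :=
  {p | p ∈ Ω ∧ ∃ x, x ≠ p.2 ∧ ∀ y ∈ arcCO p.2 x, (p.1, y) ∈ Ω}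

namespace SurfacePolygon

variable {g : ℕ} (S : SurfacePolygon g)

/-- A choice of parameters: `A i ∈ [P i, Q i]`. -/
def IsParameter (A : Index g → Circle) : Prop :=
  ∀ i, A i ∈ arc (S.P i) (S.Q i)

/-- The label `i` with `w ∈ [A i, A (i+1))`. -/
def label (A : Index g → Circle) (w : Circle) : Index g :=
  Classical.epsilon fun i => w ∈ arcCO (A i) (A (i + 1))

/-- `F_A(u, w) = (T_i u, T_i w)` if `w ∈ [A i, A (i+1))`. -/
def F (A : Index g → Circle) (p : Circle × Circle) : Circle × Circle :=
  (S.T (label A p.2) • p.1, S.T (label A p.2) • p.2)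

/-- `Ω` is a bijectivity domain of `F_A` with finite rectangular structure. As `F_A` is defined
with half-open arcs, upper horizontal edges are left out; then `F_A` maps the domain onto itself,
and it is injective except over finitely many vertical lines. -/
structure IsDomain (A : Index g → Circle) (Ω : Set (Circle × Circle)) : Prop where
  finiteRectangular : FiniteRectangular Ω
  image_eq : S.F A '' lowerPart Ω = lowerPart Ω
  injOn : ∃ E : Set Circle, E.Finite ∧ Set.InjOn (S.F A) {p ∈ lowerPart Ω | (S.F A p).1 ∉ E}

/-- `D` is dual to `A`, where `ΩA` and `ΩD` are the domains of `F_A` and `F_D`: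
`φ(ΩA) = ΩD` for `φ(x, y) = (y, x)`, and if `p = (u, w)` is in `ΩA` off its upper horizontal edges
and `u ∉ D`, then `p` has exactly one preimage `F_A⁻¹(p)`, and `φ(F_A⁻¹(p)) = F_D(φ(p))`. -/
structure IsDual (A : Index g → Circle) (ΩA : Set (Circle × Circle))
    (D : Index g → Circle) (ΩD : Set (Circle × Circle)) : Prop where
  isParameter_left : S.IsParameter A
  isParameter_right : S.IsParameter D
  isDomain_left : S.IsDomain A ΩA
  isDomain_right : S.IsDomain D ΩD
  swap_image : Prod.swap '' ΩA = ΩD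
  swap_preimage : ∀ p ∈ lowerPart ΩA, p.1 ∉ Set.range D →
    ∃ q ∈ lowerPart ΩA, S.F A q = p ∧ (∀ q' ∈ lowerPart ΩA, S.F A q' = p → q' = q) ∧
      q.swap = S.F D p.swap

/-! ### The domains for extremal parameters -/

/-- The system of equations for `G₁, …, Gₙ`, `n = 8g-4`, belonging to extremal parameters `A`. -/
structure IsSolution (A : Index g → Circle) (G : Index g → Circle) : Prop where
  mem_arc : ∀ i, G i ∈ arc (S.P i) (S.P (i + 1))
  eq_of_P : ∀ i, A i = S.P i → G (sigma i) = S.T i • G (i - 2)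
  eq_of_Q : ∀ i, A i = S.Q i → G (sigma i) = S.T (tau i + 1) • G (tau i)

/-- `H_i = T_{σ(i)} T_{τ(i)-1} G_{τ(i)-1}`. -/
def H (G : Index g → Circle) (i : Index g) : Circle :=
  S.T (sigma i) • S.T (tau i - 1) • G (tau i - 1)

/-- The domain `Ω_A` for extremal parameters `A`: the union of the rectangles
`[H_{i+1}, G_{i-2}] × [P_i, Q_i]` and `[H_{i+1}, G_{i-1}] × [Q_i, P_{i+1}]`, where `G` is the
solution of the system of equations belonging to `A`. -/
def Ω (A : Index g → Circle) : Set (Circle × Circle) :=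
  {p | ∃ G, S.IsSolution A G ∧
    p ∈ ⋃ i, arc (S.H G (i + 1)) (G (i - 2)) ×ˢ arc (S.P i) (S.Q i) ∪
      arc (S.H G (i + 1)) (G (i - 1)) ×ˢ arc (S.Q i) (S.P (i + 1))}

/-- `{P₁, Q₂, P₃, Q₄, …}` -/
def altPQ (i : Index g) : Circle := if Odd i.val then S.P i else S.Q i

/-- `{Q₁, P₂, Q₃, P₄, …}` -/
def altQP (i : Index g) : Circle := if Odd i.val then S.Q i else S.P i

/-- `{P₁, P₂, Q₃, Q₄, P₅, P₆, Q₇, Q₈, …}` -/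
def pairsPQ (i : Index g) : Circle :=
  if i.val % 4 = 1 ∨ i.val % 4 = 2 then S.P i else S.Q i

/-- `{Q₁, Q₂, P₃, P₄, Q₅, Q₆, P₇, P₈, …}` -/
def pairsQP (i : Index g) : Circle :=
  if i.val % 4 = 1 ∨ i.val % 4 = 2 then S.Q i else S.P i

end SurfacePolygon

end BowenSeries

end

open ComplexConjugate

namespace BowenSeries

open Complex (UnitDisc)

/-! ### The cyclic order of the unit circle -/

/-! The side pairings move the endpoints `P k`, `Q k` among themselves in a controlled way, which
turns everything into finite combinatorics. Since `T i` takes side `i` to side `σ(i)` with reversed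
direction, it sends `P i` to `Q (σ(i)+1)` and `Q (i+1)` to `P (σ(i))`. The extension condition
supplies the rest: an extended side may not enter a tile, so the angles at `V j` and `V (ρ(j))` add
up to at most `π`; the four angles of a vertex cycle close up, which forces equality (`angle_mul`).
Hence `T i` also takes the geodesic of side `i-1` onto that of side `σ(i)+1` (`T_Q`, `T_P_pred`),
and, passing to inverses, that of side `i+1` onto that of side `σ(i)-1`.

Extremal parameters are coded by `e` with values 0 (for `P`) and 1 (for `Q`). In all the cases of
the theorem `e` has period 4, and `σ(i)` and `τ(i)` are both `i+2` modulo 4. For such `e` the points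
`G i` can be taken among the `P k` (`isSolution_sol`), and there is no other solution because each
`G j` is fixed by a product of two side pairings that contracts an arc (`fixed_unique`). So the
domain is an explicit union of rectangles with corners at marked points (`Ω_param`).

Let `D` have type `d(i) = 1 - e(i+2)`. Cut the domain of `A` horizontally at the points of `A` and
vertically at the points of `D`. Then `T i` takes the horizontal piece with label `i` exactly onto
the vertical piece with label `σ(i)` (`smul_mem_imageStrip`). So the natural extension is bijective
away from the lines over `D`, and its inverse on the vertical piece `s` is `T s`, which is what the
map for `D` applies after the coordinates are exchanged (`isDual_dom`). The exchange takes one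
domain to the other (`swap_image_dom`). Inclusions between pieces are inequalities between integer
positions on the circle (`Loc`). The four claims are the values of `e` on residues modulo 4. -/

/-- Twice the signed area of the triangle `abc`. -/
noncomputable def area (a b c : Circle) : ℝ := (conj ((b : ℂ) - a) * ((c : ℂ) - a)).im

/-- The stereographic coordinate on the circle that sends `a` to infinity and increases
counterclockwise. -/
noncomputable def cut (a x : Circle) : ℝ :=
  (conj (a : ℂ) * x).im / ((conj (a : ℂ) * x).re - 1)

theorem circle_sq (a : Circle) : (a : ℂ).re * (a : ℂ).re + (a : ℂ).im * (a : ℂ).im = 1 := by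
  have := a.normSq_coe
  rwa [Complex.normSq_apply] at this

theorem area_rotate (a b c : Circle) : area b c a = area a b c := by
  simp only [area, Complex.mul_im, Complex.conj_re, Complex.conj_im, Complex.sub_re,
    Complex.sub_im]
  ring

theorem area_swap (a b c : Circle) : area a c b = -area a b c := by
  simp only [area, Complex.mul_im, Complex.conj_re, Complex.conj_im, Complex.sub_re,
    Complex.sub_im]
  ring

theorem re_conj_mul_lt_one {a b : Circle} (h : a ≠ b) : (conj (a : ℂ) * b).re < 1 := by
  have ha := circle_sq a
  have hb := circle_sq b
  simp only [Complex.mul_re, Complex.conj_re, Complex.conj_im]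
  by_contra! h'
  apply h
  have h1 : (a : ℂ).re - (b : ℂ).re = 0 := by
    apply pow_eq_zero_iff (two_ne_zero) |>.1
    nlinarith [sq_nonneg ((a : ℂ).re - (b : ℂ).re), sq_nonneg ((a : ℂ).im - (b : ℂ).im)]
  have h2 : (a : ℂ).im - (b : ℂ).im = 0 := by
    apply pow_eq_zero_iff (two_ne_zero) |>.1
    nlinarith [sq_nonneg ((a : ℂ).re - (b : ℂ).re), sq_nonneg ((a : ℂ).im - (b : ℂ).im)]
  exact Circle.ext (Complex.ext (by linarith) (by linarith))

/-- Both outer factors are positive, so the cyclic order seen from `a` is the order of the real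
numbers `cut a _`. Transitivity of `Ccw` rests on this. -/
theorem area_eq_cut {a b c : Circle} (hb : a ≠ b) (hc : a ≠ c) :
    area a b c = (1 - (conj (a : ℂ) * b).re) * (1 - (conj (a : ℂ) * c).re) *
      (cut a c - cut a b) := by
  have h1 := re_conj_mul_lt_one hb
  have h2 := re_conj_mul_lt_one hc
  have h1' : (conj (a : ℂ) * b).re - 1 ≠ 0 := by linarith
  have h2' : (conj (a : ℂ) * c).re - 1 ≠ 0 := by linarith
  have ha := circle_sq a
  have key : area a b c = ((conj (a : ℂ) * b).re - 1) * (conj (a : ℂ) * c).im -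
      (conj (a : ℂ) * b).im * ((conj (a : ℂ) * c).re - 1) := by
    simp only [area, Complex.mul_im, Complex.mul_re, Complex.conj_re, Complex.conj_im,
      Complex.sub_re, Complex.sub_im]
    linear_combination ((b : ℂ).im * (c : ℂ).re - (b : ℂ).re * (c : ℂ).im) * ha
  rw [key, cut, cut]
  field_simp
  ring

theorem ccw_iff_area {a b c : Circle} : Ccw a b c ↔ 0 < area a b c := Iff.rfl

theorem Ccw.ne₁₂ {a b c : Circle} (h : Ccw a b c) : a ≠ b := by
  rintro rfl; simp [Ccw] at h

theorem Ccw.rotate {a b c : Circle} (h : Ccw a b c) : Ccw b c a := by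
  rw [ccw_iff_area] at *; rwa [area_rotate]

theorem Ccw.ne₂₃ {a b c : Circle} (h : Ccw a b c) : b ≠ c := h.rotate.ne₁₂

theorem Ccw.ne₁₃ {a b c : Circle} (h : Ccw a b c) : a ≠ c := h.rotate.rotate.ne₁₂.symm

theorem Ccw.not_swap {a b c : Circle} (h : Ccw a b c) : ¬ Ccw a c b := by
  rw [ccw_iff_area] at *; rw [area_swap]; linarith

theorem ccw_iff_cut {a b c : Circle} (hb : a ≠ b) (hc : a ≠ c) :
    Ccw a b c ↔ cut a b < cut a c := by
  have h1 := re_conj_mul_lt_one hb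
  have h2 := re_conj_mul_lt_one hc
  rw [ccw_iff_area, area_eq_cut hb hc, mul_pos_iff_of_pos_left
    (mul_pos (by linarith) (by linarith)), sub_pos]

theorem cut_injective {a b c : Circle} (hb : a ≠ b) (hc : a ≠ c) (h : cut a b = cut a c) :
    b = c := by
  have h1 := re_conj_mul_lt_one hb
  have h2 := re_conj_mul_lt_one hc
  have key : ∀ B C : ℂ, B.re * B.re + B.im * B.im = 1 → C.re * C.re + C.im * C.im = 1 →
      B.re < 1 → C.re < 1 → B.im / (B.re - 1) = C.im / (C.re - 1) → B = C := by
    intro B C hB hC hB1 hC1 h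
    rw [div_eq_div_iff (by linarith) (by linarith)] at h
    have e : B.re = C.re := by
      -- After squaring, the circle equations eliminate the imaginary parts.
      have h3 : (B.im * (C.re - 1)) ^ 2 = (C.im * (B.re - 1)) ^ 2 := by rw [h]
      have h4 : (1 - B.re) * (1 - C.re) * (2 * (B.re - C.re)) = 0 := by
        linear_combination h3 + (C.re - 1) ^ 2 * (- hB) + (B.re - 1) ^ 2 * hC
      have h5 : (1 - B.re) * (1 - C.re) ≠ 0 := (mul_pos (by linarith) (by linarith)).ne'
      have := (mul_eq_zero.1 h4).resolve_left h5
      linarith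
    refine Complex.ext e ?_
    rw [e] at h
    exact mul_right_cancel₀ (by linarith) h
  have h3 : conj (a : ℂ) * b = conj (a : ℂ) * c := by
    refine key _ _ ?_ ?_ h1 h2 h
    · have := circle_sq (a⁻¹ * b); simpa [Circle.coe_inv_eq_conj] using this
    · have := circle_sq (a⁻¹ * c); simpa [Circle.coe_inv_eq_conj] using this
  refine Circle.ext (mul_left_cancel₀ ?_ h3)
  simp

theorem exists_cut_eq (a : Circle) (t : ℝ) : ∃ x, a ≠ x ∧ cut a x = t := by
  have h0 : (1 + t ^ 2) ≠ 0 := by positivity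
  have hs : ((t ^ 2 - 1) / (1 + t ^ 2)) * ((t ^ 2 - 1) / (1 + t ^ 2)) +
      (-2 * t / (1 + t ^ 2)) * (-2 * t / (1 + t ^ 2)) = 1 := by field_simp; ring
  -- Inverse stereographic projection from `1`; multiplication by `a` moves the pole to `a`.
  let y : Circle := ⟨⟨(t ^ 2 - 1) / (1 + t ^ 2), -2 * t / (1 + t ^ 2)⟩, by
    refine mem_sphere_zero_iff_norm.2 ?_
    rw [← sq_eq_sq₀ (norm_nonneg _) zero_le_one,
      ← Complex.normSq_eq_norm_sq, Complex.normSq_apply]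
    simpa using hs⟩
  have hy : conj (a : ℂ) * ((a * y : Circle) : ℂ) = y := by
    rw [Circle.coe_mul, ← mul_assoc, mul_comm (conj (a : ℂ)), Complex.mul_conj,
      a.normSq_coe]; simp
  have h1 : ((y : ℂ).re - 1) = -2 / (1 + t ^ 2) := by
    change (t ^ 2 - 1) / (1 + t ^ 2) - 1 = _
    field_simp; ring
  refine ⟨a * y, ?_, ?_⟩
  · intro h
    have : y = 1 := by simpa using h.symm
    rw [this] at h1
    have : (-2 : ℝ) / (1 + t ^ 2) < 0 := div_neg_of_neg_of_pos (by norm_num) (by positivity)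
    simp only [Circle.coe_one, Complex.one_re, sub_self] at h1
    linarith
  · rw [cut, hy, h1]
    change -2 * t / (1 + t ^ 2) / _ = _
    field_simp

theorem ccw_or_ccw {a b c : Circle} (hab : a ≠ b) (hac : a ≠ c) (hbc : b ≠ c) :
    Ccw a b c ∨ Ccw a c b := by
  rw [ccw_iff_cut hab hac, ccw_iff_cut hac hab]
  exact lt_or_gt_of_ne fun h => hbc (cut_injective hab hac h)

theorem Ccw.trans {a b c d : Circle} (h : Ccw a b c) (h' : Ccw a c d) : Ccw a b d := by
  rw [ccw_iff_cut h.ne₁₂ h'.ne₁₃]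
  exact ((ccw_iff_cut h.ne₁₂ h.ne₁₃).1 h).trans ((ccw_iff_cut h'.ne₁₂ h'.ne₁₃).1 h')

theorem Ccw.trans' {a b c d : Circle} (h : Ccw a b c) (h' : Ccw a c d) : Ccw b c d :=
  (h'.rotate.trans h.rotate.rotate).rotate.rotate

theorem exists_ccw {a b : Circle} (h : a ≠ b) : ∃ x, Ccw a x b := by
  obtain ⟨x, hx, e⟩ := exists_cut_eq a (cut a b - 1)
  exact ⟨x, (ccw_iff_cut hx h).2 (by linarith)⟩

/-! ### Möbius transformations and the cyclic order -/

/-- The factor by which `M` contracts at `z`. -/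
noncomputable def jac (M : SU11) (z : ℂ) : ℝ := Complex.normSq (M.1 1 0 * z + M.1 1 1)

theorem jac_pos (M : SU11) {z : ℂ} (hz : Complex.normSq z ≤ 1) : 0 < jac M z :=
  Complex.normSq_pos.2 (SU11.denom_ne_zero M hz)

theorem su11_entries (M : SU11) : M.1 1 1 = conj (M.1 0 0) ∧ M.1 1 0 = conj (M.1 0 1) ∧
    Complex.normSq (M.1 0 0) - Complex.normSq (M.1 0 1) = 1 := by
  obtain ⟨⟨M, hdet⟩, h1, h2⟩ := M
  replace h1 : M 1 1 = conj (M 0 0) := h1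
  replace h2 : M 1 0 = conj (M 0 1) := h2
  refine ⟨h1, h2, ?_⟩
  rw [Matrix.det_fin_two, h1, h2, Complex.mul_conj, Complex.mul_conj] at hdet
  exact_mod_cast hdet

theorem coe_smul_circle (M : SU11) (a : Circle) : ((M • a : Circle) : ℂ) = SU11.moebius M a := rfl

theorem coe_smul_disc (M : SU11) (z : UnitDisc) : ((M • z : UnitDisc) : ℂ) = SU11.moebius M z := rfl

/-- In the hyperboloid model, `M` is linear: the space components. -/
theorem moebius_mul_jac (M : SU11) {z : ℂ} (hz : Complex.normSq z ≤ 1) :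
    SU11.moebius M z * jac M z = M.1 0 0 * M.1 0 1 * (1 + Complex.normSq z) +
      M.1 0 0 ^ 2 * z + M.1 0 1 ^ 2 * conj z := by
  obtain ⟨h1, h2, -⟩ := su11_entries M
  rw [jac, ← Complex.mul_conj, SU11.moebius, ← mul_assoc,
    div_mul_cancel₀ _ (SU11.denom_ne_zero M hz), h1, h2, ← Complex.mul_conj]
  simp only [map_add, map_mul, Complex.conj_conj]
  ring

/-- In the hyperboloid model, `M` is linear: the time component. -/
theorem normSq_moebius_mul_jac (M : SU11) {z : ℂ} (hz : Complex.normSq z ≤ 1) :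
    (1 + Complex.normSq (SU11.moebius M z)) * jac M z =
      (Complex.normSq (M.1 0 0) + Complex.normSq (M.1 0 1)) * (1 + Complex.normSq z) +
        4 * (M.1 0 0 * z * conj (M.1 0 1)).re := by
  obtain ⟨h1, h2, -⟩ := su11_entries M
  rw [jac, add_mul, ← Complex.normSq_mul, SU11.moebius,
    div_mul_cancel₀ _ (SU11.denom_ne_zero M hz), one_mul, h1, h2]
  simp only [Complex.normSq_apply, Complex.mul_im, Complex.mul_re, Complex.conj_re,
    Complex.conj_im, Complex.add_re, Complex.add_im]
  ring

theorem jac_circle (M : SU11) (a : Circle) :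
    jac M a = Complex.normSq (M.1 0 0) + Complex.normSq (M.1 0 1) +
        2 * (M.1 0 0 * a * conj (M.1 0 1)).re := by
  have h := normSq_moebius_mul_jac M a.normSq_coe.le
  rw [← coe_smul_circle, Circle.normSq_coe, Circle.normSq_coe] at h
  linarith

/-- `geodesicSide a b z` is the determinant of the hyperboloid vectors `(1, a)`, `(1, b)`, `(1 +
|z|², 2z)`. Up to the factors `jac`, `M` acts on these by one linear map, of determinant `(|p|² -
|q|²)³ = 1` for the first row `p, q` of `M`. -/
theorem geodesicSide_moebius (M : SU11) (a b : Circle) {z : ℂ} (hz : Complex.normSq z ≤ 1) :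
    geodesicSide (M • a) (M • b) (SU11.moebius M z) * (jac M a * jac M b * jac M z) =
      geodesicSide a b z := by
  obtain ⟨h1, h2, hd⟩ := su11_entries M
  have ea := moebius_mul_jac M a.normSq_coe.le
  have eb := moebius_mul_jac M b.normSq_coe.le
  have ez := moebius_mul_jac M hz
  have key : geodesicSide (M • a) (M • b) (SU11.moebius M z) * (jac M a * jac M b * jac M z) =
      ((1 + Complex.normSq (SU11.moebius M z)) * jac M z) *
        (conj (SU11.moebius M a * jac M a) * (SU11.moebius M b * jac M b)).im +
      2 * (conj (SU11.moebius M b * jac M b * jac M a - SU11.moebius M a * jac M a * jac M b) *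
        (SU11.moebius M z * jac M z)).im := by
    rw [geodesicSide, coe_smul_circle, coe_smul_circle]
    simp only [Complex.mul_im, Complex.mul_re, Complex.conj_re, Complex.conj_im,
      Complex.sub_re, Complex.sub_im, Complex.ofReal_re, Complex.ofReal_im]
    ring
  rw [key, ea, eb, ez, normSq_moebius_mul_jac M hz, jac_circle, jac_circle, geodesicSide,
    Circle.normSq_coe, Circle.normSq_coe]
  clear key ea eb ez h1 h2
  generalize M.1 0 0 = p at *
  generalize M.1 0 1 = q at *
  generalize (a : ℂ) = a at *
  generalize (b : ℂ) = b at *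
  generalize hs : Complex.normSq z = s at *
  clear hs hz
  obtain ⟨p1, p2⟩ := p
  obtain ⟨q1, q2⟩ := q
  obtain ⟨a1, a2⟩ := a
  obtain ⟨b1, b2⟩ := b
  obtain ⟨z1, z2⟩ := z
  simp only [Complex.normSq_apply] at hd ⊢
  simp only [pow_two, Complex.mul_im, Complex.mul_re, Complex.conj_re,
    Complex.conj_im, Complex.sub_re, Complex.sub_im, Complex.add_re, Complex.add_im,
    Complex.ofReal_re, Complex.ofReal_im, Complex.one_re, Complex.one_im]
  have h3 : (p1 * p1 + p2 * p2 - (q1 * q1 + q2 * q2)) ^ 3 = 1 := by rw [hd, one_pow]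
  linear_combination ((1 + s) * (a1 * b2 - a2 * b1) + 2 * ((b1 - a1) * z2 - (b2 - a2) * z1)) * h3

theorem geodesicSide_circle (a b c : Circle) : geodesicSide a b c = 2 * area a b c := by
  rw [geodesicSide, Circle.normSq_coe, area]
  simp only [Complex.mul_im, Complex.conj_re, Complex.conj_im, Complex.sub_re,
    Complex.sub_im]
  ring

theorem geodesicSide_swap (a b : Circle) (z : ℂ) : geodesicSide b a z = -geodesicSide a b z := by
  simp only [geodesicSide, Complex.mul_im, Complex.conj_re, Complex.conj_im, Complex.sub_re,
    Complex.sub_im]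
  ring

theorem area_smul (M : SU11) (a b c : Circle) :
    area (M • a) (M • b) (M • c) * (jac M a * jac M b * jac M c) = area a b c := by
  have h := geodesicSide_moebius M a b c.normSq_coe.le
  rw [← coe_smul_circle, geodesicSide_circle, geodesicSide_circle] at h
  linarith

theorem jac_circle_pos (M : SU11) (a : Circle) : 0 < jac M a := jac_pos M a.normSq_coe.le

theorem ccw_smul (M : SU11) {a b c : Circle} : Ccw (M • a) (M • b) (M • c) ↔ Ccw a b c := by
  rw [ccw_iff_area, ccw_iff_area, ← area_smul M a b c, mul_pos_iff_of_pos_right]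
  have := jac_circle_pos M a
  have := jac_circle_pos M b
  have := jac_circle_pos M c
  positivity

theorem smul_mem_arc (M : SU11) {a b x : Circle} : M • x ∈ arc (M • a) (M • b) ↔ x ∈ arc a b := by
  simp only [arc, Set.mem_ofPred_eq, ccw_smul, smul_left_cancel_iff]

theorem smul_mem_arcCO (M : SU11) {a b x : Circle} :
    M • x ∈ arcCO (M • a) (M • b) ↔ x ∈ arcCO a b := by
  simp only [arcCO, Set.mem_ofPred_eq, ccw_smul, smul_left_cancel_iff, ne_eq]

theorem geodesicSide_smul_pos (M : SU11) (a b : Circle) (z : UnitDisc) :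
    0 < geodesicSide (M • a) (M • b) (M • z : UnitDisc) ↔ 0 < geodesicSide a b z := by
  rw [← geodesicSide_moebius M a b z.normSq_lt_one.le, mul_pos_iff_of_pos_right]
  · rfl
  have := jac_circle_pos M a
  have := jac_circle_pos M b
  have := jac_pos M z.normSq_lt_one.le
  positivity

theorem smul_mem_geodesic (M : SU11) (a b : Circle) (z : UnitDisc) :
    M • z ∈ geodesic (M • a) (M • b) ↔ z ∈ geodesic a b := by
  change geodesicSide (M • a) (M • b) (SU11.moebius M z) = 0 ↔ geodesicSide a b z = 0
  rw [← geodesicSide_moebius M a b z.normSq_lt_one.le]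
  have := jac_circle_pos M a
  have := jac_circle_pos M b
  have := jac_pos M z.normSq_lt_one.le
  rw [mul_eq_zero_iff_right (by positivity)]

/-- `1 - Re(conj a * b)` is the Lorentz product of the light-like vectors `(1, a)` and `(1, b)`,
which the linear action of `M` preserves up to the factors `jac`. -/
theorem chord_smul (M : SU11) (a b : Circle) :
    (1 - (conj ((M • a : Circle) : ℂ) * (M • b : Circle)).re) * (jac M a * jac M b) =
      1 - (conj (a : ℂ) * b).re := by
  obtain ⟨h1, h2, hd⟩ := su11_entries M
  have ea := moebius_mul_jac M a.normSq_coe.le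
  have eb := moebius_mul_jac M b.normSq_coe.le
  have key : (conj ((M • a : Circle) : ℂ) * (M • b : Circle)).re * (jac M a * jac M b) =
      (conj (SU11.moebius M a * jac M a) * (SU11.moebius M b * jac M b)).re := by
    rw [coe_smul_circle, coe_smul_circle]
    simp only [Complex.mul_im, Complex.mul_re, Complex.conj_re, Complex.conj_im,
      Complex.ofReal_re, Complex.ofReal_im]
    ring
  rw [sub_mul, key, ea, eb, jac_circle, jac_circle, Circle.normSq_coe, Circle.normSq_coe]
  clear key ea eb h1 h2
  generalize M.1 0 0 = p at *
  generalize M.1 0 1 = q at *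
  generalize (a : ℂ) = a at *
  generalize (b : ℂ) = b at *
  obtain ⟨p1, p2⟩ := p
  obtain ⟨q1, q2⟩ := q
  obtain ⟨a1, a2⟩ := a
  obtain ⟨b1, b2⟩ := b
  simp only [Complex.normSq_apply] at hd ⊢
  simp only [pow_two, Complex.mul_im, Complex.mul_re, Complex.conj_re,
    Complex.conj_im, Complex.add_re, Complex.add_im,
    Complex.ofReal_re, Complex.ofReal_im, Complex.one_re, Complex.one_im]
  have h3 : (p1 * p1 + p2 * p2 - (q1 * q1 + q2 * q2)) ^ 2 = 1 := by rw [hd, one_pow]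
  linear_combination (1 - (a1 * b1 + a2 * b2)) * h3

/-- Around a fixed point, a Möbius transformation is affine. -/
theorem cut_smul_of_fixed {M : SU11} {x y z : Circle} (hx : M • x = x) (hy : M • y = y)
    (hxy : x ≠ y) (hxz : x ≠ z) :
    cut x (M • z) - cut x y = jac M x * (cut x z - cut x y) := by
  have hxz' : x ≠ M • z := fun h => hxz (MulAction.injective M (hx.trans h))
  have e1 := area_eq_cut hxy hxz
  have e2 := area_eq_cut hxy hxz'
  have a1 := area_smul M x y z
  have c1 := chord_smul M x y
  have c2 := chord_smul M x z
  rw [hx, hy] at a1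
  rw [hx, hy] at c1
  rw [hx] at c2
  have p1 := re_conj_mul_lt_one hxy
  have p2 := re_conj_mul_lt_one hxz
  have p3 := re_conj_mul_lt_one hxz'
  have j1 := jac_circle_pos M x
  have j2 := jac_circle_pos M y
  have j3 := jac_circle_pos M z
  set A := 1 - (conj (x : ℂ) * y).re
  set B := 1 - (conj (x : ℂ) * z).re
  set C := 1 - (conj (x : ℂ) * (M • z : Circle)).re
  have hA : 0 < A := by simp only [A]; linarith
  have hC : 0 < C := by simp only [C]; linarith
  rw [e1, e2, ← c2] at a1
  have hne : A * C * (jac M y * jac M z * jac M x) ≠ 0 := by positivity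
  -- The factors at the two fixed points are reciprocal, because the chord between them is
  -- preserved.
  have h1 : jac M x * jac M y = 1 := by
    apply mul_left_cancel₀ hA.ne'; linarith
  apply mul_left_cancel₀ hne
  clear_value A B C
  linear_combination a1 - A * C * jac M x * jac M z * (cut x z - cut x y) * h1

/-- Suppose there were two fixed points, in the order `a, x, y, b`. In the coordinate that sends `x`
to infinity, `M` is a dilation about `y`, with `y < b < a`. Moving `b` down needs a factor below 1,
moving `a` up a factor above 1. -/
theorem fixed_eq_of_contracting {M : SU11} {a b x y : Circle} (h : Ccw a (M • a) (M • b))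
    (h' : Ccw a (M • b) b) (hx : x ∈ arc a b) (hy : y ∈ arc a b) (hMx : M • x = x)
    (hMy : M • y = y) : x = y := by
  have key : ∀ {x y : Circle}, M • x = x → M • y = y → Ccw a x y → Ccw a y b → False := by
    intro x y hx hy h1 h2
    have xyb : Ccw x y b := h1.trans' h2
    have xba : Ccw x b a := (h1.trans h2).rotate
    have xMab : Ccw (M • a) x (M • b) := by
      have := (ccw_smul M).2 (h1.trans h2)
      rwa [hx] at this
    have axMb : Ccw a x (M • b) := (h.rotate.rotate.trans xMab.rotate.rotate).rotate
    have xMbb : Ccw x (M • b) b := axMb.trans' h'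
    have xaMa : Ccw x a (M • a) := (h.rotate.rotate.trans' xMab.rotate.rotate).rotate.rotate
    have e1 := cut_smul_of_fixed hx hy xyb.ne₁₂ xba.ne₁₂
    have e2 := cut_smul_of_fixed hx hy xyb.ne₁₂ xba.ne₁₃
    have l1 := (ccw_iff_cut xMbb.ne₁₂ xMbb.ne₁₃).1 xMbb
    have l2 := (ccw_iff_cut xaMa.ne₁₂ xaMa.ne₁₃).1 xaMa
    have l3 := (ccw_iff_cut xyb.ne₁₂ xyb.ne₁₃).1 xyb
    have l4 := (ccw_iff_cut xba.ne₁₂ xba.ne₁₃).1 xba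
    nlinarith
  have ha : M • a ≠ a := h.ne₁₂.symm
  have hb : M • b ≠ b := h'.ne₂₃
  have hx' : Ccw a x b := by
    rcases hx with rfl | rfl | hx
    exacts [absurd hMx ha, absurd hMx hb, hx]
  have hy' : Ccw a y b := by
    rcases hy with rfl | rfl | hy
    exacts [absurd hMy ha, absurd hMy hb, hy]
  by_contra hxy
  rcases ccw_or_ccw hx'.ne₁₂ hy'.ne₁₂ hxy with h1 | h1
  · exact key hMx hMy h1 hy'
  · exact key hMy hMx h1 hx'

/-! ### Isometries near a point: centring, rotations and rays -/

/-- A Möbius transformation that fixes `0` is a rotation. -/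
theorem exists_rotation_of_fixes_zero {M : SU11} (h : M • (0 : UnitDisc) = 0) :
    ∃ c : Circle, (∀ x : Circle, M • x = c * x) ∧
      ∀ z : UnitDisc, ((M • z : UnitDisc) : ℂ) = c * z := by
  obtain ⟨h1, h2, hd⟩ := su11_entries M
  have e0 := congrArg (fun z : UnitDisc => (z : ℂ)) h
  have hne := SU11.denom_ne_zero M (z := 0) (by simp)
  simp only [coe_smul_disc, SU11.moebius, UnitDisc.coe_zero, mul_zero, zero_add] at e0 hne
  have hq : M.1 0 1 = 0 := (div_eq_zero_iff.1 e0).resolve_right hne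
  rw [hq, map_zero, sub_zero] at hd
  rw [hq, map_zero] at h2
  have hn : ‖M.1 0 0 / M.1 1 1‖ = 1 := by
    rw [norm_div, h1, Complex.norm_conj, div_self]
    intro h0
    rw [Complex.normSq_eq_norm_sq, h0] at hd
    norm_num at hd
  have key : ∀ z : ℂ, SU11.moebius M z = M.1 0 0 / M.1 1 1 * z := by
    intro z
    rw [SU11.moebius, hq, h2, add_zero, zero_mul, zero_add, div_mul_eq_mul_div]
  exact ⟨⟨_, mem_sphere_zero_iff_norm.2 hn⟩, fun x => Circle.ext (key x), fun z => key z⟩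

/-- Transfers the relations among the side pairings from the disk to the boundary. Fixing `0` makes
`M` a rotation, and the point `1/2` shows that the rotation is trivial. -/
theorem circle_smul_eq_of_disc {M : SU11} (h : ∀ z : UnitDisc, M • z = z) (x : Circle) :
    M • x = x := by
  obtain ⟨c, h1, h2⟩ := exists_rotation_of_fixes_zero (h 0)
  have hh : ‖(1 / 2 : ℂ)‖ < 1 := by norm_num
  have e1 := h2 (.mk (1 / 2) hh)
  rw [h, UnitDisc.coe_mk] at e1
  have : c = 1 := Circle.ext (by rw [Circle.coe_one]; linear_combination -2 * e1)
  rw [h1, this, one_mul]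

theorem exists_smul_eq_zero (v : UnitDisc) : ∃ M : SU11, M • v = 0 := by
  have hv : 0 < 1 - Complex.normSq v := by linarith [v.normSq_lt_one]
  -- Normalises the matrix with rows `(1, -v)` and `(-conj v, 1)` to determinant 1.
  set r : ℝ := (Real.sqrt (1 - Complex.normSq v))⁻¹ with hr
  have hr2 : r * r * (1 - Complex.normSq v) = 1 := by
    rw [hr, ← mul_inv, Real.mul_self_sqrt hv.le, inv_mul_cancel₀ hv.ne']
  have hc : (v : ℂ) * conj (v : ℂ) = Complex.normSq v := Complex.mul_conj _
  refine ⟨⟨⟨!![(r : ℂ), -r * v; -r * conj (v : ℂ), r], ?_⟩, ?_⟩, ?_⟩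
  · rw [Matrix.det_fin_two_of]
    have : ((r * r * (1 - Complex.normSq v) : ℝ) : ℂ) = 1 := by rw [hr2]; simp
    push_cast at this
    linear_combination this - r * r * hc
  · constructor <;> simp
  · apply UnitDisc.coe_injective
    rw [coe_smul_disc, SU11.moebius]
    simp

/-- A Möbius transformation that moves `v` to `0`. -/
noncomputable def center (v : UnitDisc) : SU11 := (exists_smul_eq_zero v).choose

theorem center_smul (v : UnitDisc) : center v • v = 0 := (exists_smul_eq_zero v).choose_spec

/-- Once `v` and `M • v` are both moved to `0`, `M` becomes an isometry fixing `0`. The same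
rotation `c` acts on directions at infinity and on the disk, so angles at `v` and at `M • v` can be
compared. -/
theorem exists_rotation (M : SU11) (v : UnitDisc) : ∃ c : Circle,
    (∀ x : Circle, center (M • v) • M • x = c * center v • x) ∧
      ∀ z : UnitDisc, ((center (M • v) • M • z : UnitDisc) : ℂ) =
        c * (center v • z : UnitDisc) := by
  have h : (center (M • v) * M * (center v)⁻¹) • (0 : UnitDisc) = 0 := by
    rw [mul_smul, ← center_smul v, inv_smul_smul, mul_smul, center_smul, center_smul]
  obtain ⟨c, h1, h2⟩ := exists_rotation_of_fixes_zero h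
  refine ⟨c, fun x => ?_, fun z => ?_⟩
  · rw [← h1, mul_smul, inv_smul_smul, mul_smul]
  · rw [← h2, mul_smul, inv_smul_smul, mul_smul]

/-- With `v` at the origin the geodesic is a diameter: its equation at `0` says that `conj a * b` is
real, and the value 1 is excluded by `a ≠ b`. -/
theorem center_smul_right {v : UnitDisc} {a b : Circle} (hab : a ≠ b) (h : v ∈ geodesic a b) :
    ((center v • b : Circle) : ℂ) = -(center v • a : Circle) := by
  have hab' : center v • a ≠ center v • b := fun h => hab (MulAction.injective _ h)
  rw [← smul_mem_geodesic (center v), center_smul] at h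
  replace h : geodesicSide (center v • a) (center v • b) ((0 : UnitDisc) : ℂ) = 0 := h
  have h1 := re_conj_mul_lt_one hab'
  have h2 : (conj ((center v • a : Circle) : ℂ) * (center v • b : Circle)).im = 0 := by
    simpa [geodesicSide] using h
  have h3 := circle_sq ((center v • a)⁻¹ * center v • b)
  rw [Circle.coe_mul, Circle.coe_inv_eq_conj, h2, mul_zero, add_zero] at h3
  have h4 : conj ((center v • a : Circle) : ℂ) * (center v • b : Circle) = -1 := by
    refine Complex.ext ?_ ?_
    · rw [Complex.neg_re, Complex.one_re]; nlinarith
    · rw [h2]; simp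
  have h5 := Complex.mul_conj ((center v • a : Circle) : ℂ)
  rw [Circle.normSq_coe, Complex.ofReal_one] at h5
  linear_combination ((center v • a : Circle) : ℂ) * h4 - ((center v • b : Circle) : ℂ) * h5

/-- The geodesic ray from `v` through `w` ends at `b`. -/
def Ahead (v w : UnitDisc) (b : Circle) : Prop :=
  ∃ r : ℝ, 0 < r ∧ ((center v • w : UnitDisc) : ℂ) = r * (center v • b : Circle)

theorem Ahead.unique {v w : UnitDisc} {b b' : Circle} (h : Ahead v w b) (h' : Ahead v w b') :
    b = b' := by
  obtain ⟨r, hr, e⟩ := h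
  obtain ⟨r', hr', e'⟩ := h'
  rw [e] at e'
  have h1 := congrArg norm e'
  rw [norm_mul, norm_mul, Circle.norm_coe, Circle.norm_coe, Complex.norm_real,
    Complex.norm_real, Real.norm_of_nonneg hr.le, Real.norm_of_nonneg hr'.le, mul_one,
    mul_one] at h1
  rw [h1] at e'
  refine MulAction.injective (center v) (Circle.ext (mul_left_cancel₀ ?_ e'))
  exact_mod_cast hr'.ne'

theorem Ahead.smul {v w : UnitDisc} {b : Circle} (h : Ahead v w b) (M : SU11) :
    Ahead (M • v) (M • w) (M • b) := by
  obtain ⟨c, h1, h2⟩ := exists_rotation M v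
  obtain ⟨r, hr, e⟩ := h
  refine ⟨r, hr, ?_⟩
  rw [h2, h1, e, Circle.coe_mul]
  ring

/-- The line `cd` crosses `ab` at `v`. Both `w` and `d` lie on the left of `ab`, hence on the same
half of `cd`. -/
theorem ahead_of_geodesic {v w : UnitDisc} {a b c d : Circle} (hv : v ∈ geodesic a b)
    (hcd : c ≠ d) (hv' : v ∈ geodesic c d) (hw : w ∈ geodesic c d)
    (hwl : 0 < geodesicSide a b w) (hd : Ccw a b d) : Ahead v w d := by
  have e1 := center_smul_right hd.ne₁₂ hv
  have e2 := center_smul_right hcd hv'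
  rw [← smul_mem_geodesic (center v)] at hw
  replace hw : geodesicSide (center v • c) (center v • d) ((center v • w : UnitDisc) : ℂ) = 0 := hw
  rw [← geodesicSide_smul_pos (center v)] at hwl
  rw [← ccw_smul (center v), ccw_iff_area, area] at hd
  rw [geodesicSide] at hw hwl
  refine ⟨(conj ((center v • d : Circle) : ℂ) * (center v • w : UnitDisc)).re, ?_, ?_⟩
  all_goals
    have hD := circle_sq (center v • d)
    rw [e1] at hwl hd
    rw [neg_eq_iff_eq_neg.1 e2.symm] at hw
    generalize ((center v • a : Circle) : ℂ) = A at *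
    generalize ((center v • d : Circle) : ℂ) = D at *
    generalize ((center v • w : UnitDisc) : ℂ) = W at *
    have hw' : D.re * W.im - D.im * W.re = 0 := by
      simp only [Complex.mul_im, Complex.conj_re, Complex.conj_im, Complex.sub_re,
        Complex.sub_im, Complex.neg_re, Complex.neg_im] at hw
      linarith
    have eW : W = ((conj D * W).re : ℝ) * D := by
      apply Complex.ext
      · simp only [Complex.mul_re, Complex.conj_re, Complex.conj_im, Complex.ofReal_re,
          Complex.ofReal_im]
        linear_combination -D.im * hw' - W.re * hD
      · simp only [Complex.mul_re, Complex.mul_im, Complex.conj_re, Complex.conj_im,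
          Complex.ofReal_re, Complex.ofReal_im]
        linear_combination D.re * hw' - W.im * hD
  · generalize (conj D * W).re = r at *
    subst eW
    simp only [Complex.mul_im, Complex.mul_re, Complex.conj_re, Complex.conj_im, Complex.sub_re,
      Complex.sub_im, Complex.neg_re, Complex.neg_im, Complex.ofReal_re, Complex.ofReal_im] at hwl hd
    have h1 : 0 < -(A.re * D.im - A.im * D.re) := by linarith
    have h2 : 0 < r * -(A.re * D.im - A.im * D.re) := by linarith
    exact (mul_pos_iff_of_pos_right h1).1 h2
  · exact eW

/-- A chord with endpoints on the left of the geodesic from `a` to `b` is on its left. -/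
theorem geodesicSide_pos_of_ccw {v : UnitDisc} {a b c d : Circle} (hcd : c ≠ d)
    (hv : v ∈ geodesic c d) (hc : Ccw a b c) (hd : Ccw a b d) :
    0 < geodesicSide a b v := by
  have e := center_smul_right hcd hv
  rw [← geodesicSide_smul_pos (center v), center_smul]
  -- With `v` at `0`, `c` and `d` are antipodal, so their areas over `ab` add up to twice the value
  -- of `geodesicSide` at `0`.
  have hc' : 0 ≤ area (center v • a) (center v • b) (center v • c) :=
    ((ccw_smul (center v)).2 hc).le
  have hd' : 0 < area (center v • a) (center v • b) (center v • d) := (ccw_smul (center v)).2 hd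
  have ha := circle_sq (center v • a)
  rw [area] at hc' hd'
  rw [geodesicSide]
  rw [e] at hd'
  simp only [UnitDisc.coe_zero, Complex.mul_im, Complex.conj_re, Complex.conj_im,
    Complex.sub_re, Complex.sub_im, Complex.neg_re, Complex.neg_im, map_zero, Complex.zero_re,
    Complex.zero_im] at hc' hd' ⊢
  nlinarith

/-! ### Arithmetic of the labels -/

theorem exists_intCast {g : ℕ} (i : Index g) : ∃ k : ℤ, (k : Index g) = i :=
  ZMod.intCast_surjective i

theorem intCast_eq_of_dvd {g : ℕ} (hg : 2 ≤ g) {a b : ℤ} (h : (8 * g - 4 : ℤ) ∣ b - a) :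
    (a : Index g) = b := by
  rw [ZMod.intCast_eq_intCast_iff_dvd_sub]
  rwa [Nat.cast_sub (by omega), Nat.cast_mul, Nat.cast_ofNat, Nat.cast_ofNat]

theorem dvd_of_intCast_eq {g : ℕ} (hg : 2 ≤ g) {a b : ℤ} (h : (a : Index g) = b) :
    (8 * g - 4 : ℤ) ∣ b - a := by
  rw [ZMod.intCast_eq_intCast_iff_dvd_sub] at h
  rwa [Nat.cast_sub (by omega), Nat.cast_mul, Nat.cast_ofNat, Nat.cast_ofNat] at h

/-- `8g - 4` is divisible by 4, so residues modulo 4 make sense for labels. -/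
theorem val_emod_four {g : ℕ} (hg : 2 ≤ g) (k : ℤ) :
    (((k : Index g).val : ℕ) : ℤ) % 4 = k % 4 := by
  have : NeZero (8 * g - 4) := ⟨by omega⟩
  rw [ZMod.val_intCast, Nat.cast_sub (by omega), Nat.cast_mul, Nat.cast_ofNat, Nat.cast_ofNat]
  exact Int.emod_emod_of_dvd k ⟨2 * g - 1, by ring⟩

theorem even_val_iff {g : ℕ} (hg : 2 ≤ g) (k : ℤ) : Even (k : Index g).val ↔ Even k := by
  have := val_emod_four hg k
  rw [Nat.even_iff, Int.even_iff]
  omega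

theorem sigma_even {g : ℕ} (hg : 2 ≤ g) {k : ℤ} (hk : Even k) :
    sigma (k : Index g) = ((2 - k : ℤ) : Index g) := by
  rw [sigma, if_pos ((even_val_iff hg k).2 hk)]; push_cast; rfl

theorem sigma_odd {g : ℕ} (hg : 2 ≤ g) {k : ℤ} (hk : ¬ Even k) :
    sigma (k : Index g) = ((4 * g - k : ℤ) : Index g) := by
  rw [sigma, if_neg (mt (even_val_iff hg k).1 hk)]; push_cast; rfl

theorem intCast_period {g : ℕ} (hg : 2 ≤ g) : ((8 * g - 4 : ℤ) : Index g) = 0 := by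
  rw [← Int.cast_zero]; exact intCast_eq_of_dvd hg ⟨-1, by ring⟩

theorem sigma_sigma {g : ℕ} (hg : 2 ≤ g) (i : Index g) : sigma (sigma i) = i := by
  obtain ⟨k, rfl⟩ := exists_intCast i
  by_cases hk : Even k
  · rw [sigma_even hg hk, sigma_even hg (by grind)]; push_cast; ring
  · rw [sigma_odd hg hk, sigma_odd hg (by grind)]; push_cast; ring

theorem sigma_add_one {g : ℕ} (hg : 2 ≤ g) (i : Index g) :
    sigma (i + 1) = sigma i + ((4 * g - 3 : ℤ) : Index g) := by
  obtain ⟨k, rfl⟩ := exists_intCast i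
  rw [← Int.cast_one, ← Int.cast_add]
  by_cases hk : Even k
  · rw [sigma_even hg hk, sigma_odd hg (by grind)]; push_cast; ring
  · rw [sigma_odd hg hk, sigma_even hg (by grind)]
    have := intCast_period hg
    push_cast at this ⊢
    linear_combination -this

theorem sigma_add_two {g : ℕ} (hg : 2 ≤ g) (i : Index g) : sigma (i + 2) = sigma i - 2 := by
  have h := sigma_add_one hg (i + 1)
  rw [sigma_add_one hg i] at h
  rw [show i + 2 = i + 1 + 1 by ring, h]
  have := intCast_period hg
  push_cast at this ⊢
  linear_combination this

theorem sigma_sub_two {g : ℕ} (hg : 2 ≤ g) (i : Index g) : sigma (i - 2) = sigma i + 2 := by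
  have := sigma_add_two hg (i - 2)
  rw [sub_add_cancel] at this
  rw [this]; ring

theorem tau_eq {g : ℕ} (hg : 2 ≤ g) (i : Index g) : tau i = i + ((4 * g - 2 : ℤ) : Index g) := by
  rw [tau, Nat.cast_sub (by omega)]; push_cast; ring

theorem tau_tau {g : ℕ} (hg : 2 ≤ g) (i : Index g) : tau (tau i) = i := by
  rw [tau_eq hg, tau_eq hg]
  have := intCast_period hg
  push_cast at this ⊢
  linear_combination this

theorem sigma_tau_add_one {g : ℕ} (hg : 2 ≤ g) (i : Index g) :
    sigma (tau i + 1) = sigma i - 1 := by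
  obtain ⟨k, rfl⟩ := exists_intCast i
  rw [tau_eq hg, ← Int.cast_add, ← Int.cast_one, ← Int.cast_add]
  by_cases hk : Even k
  · rw [sigma_even hg hk, sigma_odd hg (by grind)]; push_cast; ring
  · rw [sigma_odd hg hk, sigma_even hg (by grind)]
    have := intCast_period hg
    push_cast at this ⊢
    linear_combination -this

theorem sigma_tau {g : ℕ} (hg : 2 ≤ g) (i : Index g) : sigma (tau i) = tau (sigma i) := by
  have h := sigma_tau_add_one hg (tau i)
  rw [tau_tau hg, sigma_add_one hg] at h
  rw [tau_eq hg (sigma i)]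
  push_cast at h ⊢
  linear_combination -h

theorem rho_rho {g : ℕ} (hg : 2 ≤ g) (i : Index g) : rho (rho i) = i + ((4 * g - 2 : ℤ) : Index g) := by
  rw [rho, rho, sigma_add_one hg, sigma_sigma hg]
  push_cast; ring

/-- `ρ²` is the shift by half a period, so vertex cycles close up after four steps. -/
theorem rho_four {g : ℕ} (hg : 2 ≤ g) (i : Index g) : rho (rho (rho (rho i))) = i := by
  rw [rho_rho hg (rho (rho i)), rho_rho hg]
  have := intCast_period hg
  push_cast at this ⊢
  linear_combination this

namespace SurfacePolygon

variable {g : ℕ} (S : SurfacePolygon g)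

/-! ### The marked points -/

/-- The marked points `…, P 0, Q 0, P 1, Q 1, …` in counterclockwise order. -/
def mark (k : ℤ) : Circle :=
  if Even k then S.P (k / 2 : ℤ) else S.Q (k / 2 : ℤ)

theorem mark_P (k : ℤ) : S.mark (2 * k) = S.P k := by
  rw [mark, if_pos (by simp), show 2 * k / 2 = k by omega]

theorem mark_Q (k : ℤ) : S.mark (2 * k + 1) = S.Q k := by
  rw [mark, if_neg (by simp), show (2 * k + 1) / 2 = k by omega]

theorem mark_add_period (hg : 2 ≤ g) (k t : ℤ) :
    S.mark (k + 2 * (8 * g - 4) * t) = S.mark k := by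
  have h : (((k + 2 * (8 * g - 4) * t) / 2 : ℤ) : Index g) = (k / 2 : ℤ) := by
    apply intCast_eq_of_dvd hg
    rw [show k + 2 * (8 * g - 4) * t = k + (8 * g - 4) * t * 2 by ring,
      Int.add_mul_ediv_right _ _ (by norm_num)]
    exact ⟨-t, by ring⟩
  have h' : Even (k + 2 * (8 * g - 4) * t) ↔ Even k := by
    rw [mul_assoc]; simp [Int.even_add]
  rw [mark, mark, h]
  simp only [h']

theorem mark_ccw_aux (hg : 2 ≤ g) {a b c : ℤ} (ha : 2 ≤ a) (hab : a < b) (hbc : b < c)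
    (hc : c < 2 * (8 * g - 4) + 2) : Ccw (S.mark a) (S.mark b) (S.mark c) := by
  -- The ordered list of points starts at `P 1`, which is mark number 2.
  have key : ∀ k : ℕ, (if Even k then S.P (k / 2 + 1 : ℕ) else S.Q (k / 2 + 1 : ℕ)) =
      S.mark (k + 2) := by
    intro k
    have h1 : Even ((k : ℤ) + 2) ↔ Even k := by simp
    have h2 : (((k : ℤ) + 2) / 2) = ((k / 2 + 1 : ℕ) : ℤ) := by omega
    rw [mark, h2]
    simp only [h1, Int.cast_natCast]
  have h := S.order (a - 2).toNat (b - 2).toNat (c - 2).toNat (by omega) (by omega) (by omega)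
  rw [key, key, key] at h
  rwa [show (((a - 2).toNat : ℕ) : ℤ) + 2 = a by omega,
    show (((b - 2).toNat : ℕ) : ℤ) + 2 = b by omega,
    show (((c - 2).toNat : ℕ) : ℤ) + 2 = c by omega] at h

theorem mark_ccw (hg : 2 ≤ g) {a b c : ℤ} (hab : a < b) (hbc : b < c)
    (hc : c < a + 2 * (8 * g - 4)) : Ccw (S.mark a) (S.mark b) (S.mark c) := by
  set N : ℤ := 2 * (8 * g - 4) with hN
  have hN0 : 0 < N := by omega
  have ht := Int.emod_add_mul_ediv (a - 2) N
  have h0 := Int.emod_nonneg (a - 2) hN0.ne'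
  have h1 := Int.emod_lt_of_pos (a - 2) hN0
  set t := (a - 2) / N
  set m := (a - 2) % N
  have e : ∀ k, S.mark k = S.mark (k - N * t) := by
    intro k
    rw [← S.mark_add_period hg (k - N * t) t, hN, sub_add_cancel]
  have e' : ∀ k, S.mark k = S.mark (k - N * t - N) := by
    intro k
    rw [e, ← S.mark_add_period hg (k - N * t - N) 1, mul_one, ← hN, sub_add_cancel]
  -- The start `a - N * t` lies in the base window `[2, N + 2)`. Marks running past its end are
  -- pulled back by one period, which only rotates the triple.
  by_cases hc' : c - N * t < N + 2
  · rw [e a, e b, e c]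
    exact S.mark_ccw_aux hg (by omega) (by omega) (by omega) (by omega)
  by_cases hb' : b - N * t < N + 2
  · rw [e a, e b, e' c]
    exact (S.mark_ccw_aux hg (by omega) (by omega) (by omega) (by omega)).rotate
  · rw [e a, e' b, e' c]
    exact (S.mark_ccw_aux hg (by omega) (by omega) (by omega) (by omega)).rotate.rotate

theorem mark_ne (hg : 2 ≤ g) {a b : ℤ} (hab : a < b) (hb : b < a + 2 * (8 * g - 4)) :
    S.mark a ≠ S.mark b := by
  by_cases h : b = a + 1
  · exact (S.mark_ccw hg hab (show b < a + 2 by omega) (by omega)).ne₁₂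
  · exact (S.mark_ccw hg (show a < a + 1 by omega) (show a + 1 < b by omega) (by omega)).ne₁₃

end SurfacePolygon

namespace SurfacePolygon

variable {g : ℕ} (S : SurfacePolygon g)

/-! ### The images of the marked points under the side pairings -/

theorem ccw_P_Q_Q (hg : 2 ≤ g) (i : Index g) : Ccw (S.P (i - 1)) (S.Q i) (S.Q (i + 1)) := by
  obtain ⟨k, rfl⟩ := exists_intCast i
  have := S.mark_ccw hg (a := 2 * (k - 1)) (b := 2 * k + 1) (c := 2 * (k + 1) + 1) (by omega)
    (by omega) (by omega)
  simpa [mark_P, mark_Q] using this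

theorem ccw_P_Q_P (hg : 2 ≤ g) (i : Index g) : Ccw (S.P (i + 1)) (S.Q (i + 2)) (S.P i) := by
  obtain ⟨k, rfl⟩ := exists_intCast i
  have := S.mark_ccw hg (a := 2 * k) (b := 2 * (k + 1)) (c := 2 * (k + 2) + 1) (by omega)
    (by omega) (by omega)
  simpa [mark_P, mark_Q] using this.rotate

theorem P_ne_Q (hg : 2 ≤ g) (i : Index g) : S.P i ≠ S.Q (i + 1) := by
  obtain ⟨k, rfl⟩ := exists_intCast i
  have := S.mark_ne hg (a := 2 * k) (b := 2 * (k + 1) + 1) (by omega) (by omega)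
  simpa [mark_P, mark_Q] using this

theorem V_mem (i : Index g) : S.V i ∈ geodesic (S.P (i - 1)) (S.Q i) := by
  have := S.right_vertex_mem (i - 1)
  rwa [sub_add_cancel] at this

/-- A vertex lies strictly to the left of the sides it is not on. -/
theorem geodesicSide_V_pos (hg : 2 ≤ g) {j k : Index g} (h : k ≠ j) (h' : k + 1 ≠ j) :
    0 < geodesicSide (S.P k) (S.Q (k + 1)) (S.V j) := by
  obtain ⟨a, rfl⟩ := exists_intCast j
  obtain ⟨b₀, rfl⟩ := exists_intCast k
  obtain ⟨b, hb, h1, h2⟩ : ∃ b : ℤ, (b₀ : Index g) = b ∧ a ≤ b ∧ b < a + (8 * g - 4) := by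
    refine ⟨a + (b₀ - a) % (8 * g - 4), intCast_eq_of_dvd hg ?_, ?_, ?_⟩
    · have := Int.emod_add_mul_ediv (b₀ - a) (8 * g - 4)
      exact ⟨-((b₀ - a) / (8 * g - 4)), by linarith⟩
    · have := Int.emod_nonneg (b₀ - a) (show (8 * g - 4 : ℤ) ≠ 0 by omega)
      omega
    · have := Int.emod_lt_of_pos (b₀ - a) (show (0 : ℤ) < 8 * g - 4 by omega)
      omega
  rw [hb] at h h' ⊢
  have h3 : b ≠ a := fun e => h (by rw [e])
  have h4 : b ≠ a + (8 * g - 4) - 1 := fun e => h' (by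
    rw [← Int.cast_one, ← Int.cast_add]
    exact intCast_eq_of_dvd hg ⟨-1, by omega⟩)
  have e0 : S.P (b : Index g) = S.mark (2 * b) := by simp [mark_P]
  have e1 : S.Q ((b : Index g) + 1) = S.mark (2 * (b + 1) + 1) := by simp [mark_Q]
  -- The vertex lies on sides `a - 1` and `a`, and one of them must end on the left of side `b` at
  -- both ends. Side `a - 1` does, except when `b` is the side just before it, which crosses it when
  -- extended.
  by_cases h5 : b = a + (8 * g - 4) - 2
  · have m := S.left_vertex_mem (a : Index g)
    have hne := S.P_ne_Q hg (a : Index g)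
    have e2 : S.P (a : Index g) = S.mark (2 * (a + (8 * g - 4))) := by
      rw [← mark_P, mul_add, ← S.mark_add_period hg _ 1]; ring_nf
    have e3 : S.Q ((a : Index g) + 1) = S.mark (2 * (a + 1 + (8 * g - 4)) + 1) := by
      rw [← Int.cast_one, ← Int.cast_add, ← mark_Q, ← S.mark_add_period hg _ 1]; ring_nf
    refine geodesicSide_pos_of_ccw hne m ?_ ?_
    · rw [e0, e1, e2]; exact S.mark_ccw hg (by omega) (by omega) (by omega)
    · rw [e0, e1, e3]; exact S.mark_ccw hg (by omega) (by omega) (by omega)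
  · have m := S.V_mem (a : Index g)
    have hne := S.P_ne_Q hg (a - 1 : Index g)
    rw [sub_add_cancel] at hne
    have e2 : S.P ((a : Index g) - 1) = S.mark (2 * (a - 1)) := by simp [mark_P]
    have e3 : S.Q (a : Index g) = S.mark (2 * a + 1) := by simp [mark_Q]
    refine geodesicSide_pos_of_ccw hne m ?_ ?_
    · rw [e0, e1, e2]
      exact (S.mark_ccw hg (by omega) (by omega) (by omega)).rotate
    · rw [e0, e1, e3]
      exact (S.mark_ccw hg (by omega) (by omega) (by omega)).rotate

theorem intCast_ne (hg : 2 ≤ g) {a b : ℤ} (h : a < b) (h' : b < a + (8 * g - 4)) :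
    (a : Index g) ≠ b := by
  intro e
  have := Int.le_of_dvd (by omega) (dvd_of_intCast_eq hg e)
  omega

theorem add_ne (hg : 2 ≤ g) (i : Index g) {c : ℤ} (h : 0 < c) (h' : c < 8 * g - 4) :
    i ≠ i + (c : Index g) := by
  obtain ⟨k, rfl⟩ := exists_intCast i
  rw [← Int.cast_add]
  exact intCast_ne hg (by omega) (by omega)

theorem ahead_Q (hg : 2 ≤ g) (i : Index g) : Ahead (S.V i) (S.V (i + 1)) (S.Q (i + 1)) := by
  refine ahead_of_geodesic (S.V_mem i) (S.P_ne_Q hg i) (S.left_vertex_mem i)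
    (S.right_vertex_mem i) ?_ (S.ccw_P_Q_Q hg i)
  have := S.geodesicSide_V_pos hg (j := i + 1) (k := i - 1) ?_ ?_
  · rwa [sub_add_cancel] at this
  · have := add_ne hg (i - 1) (c := 2) (by omega) (by omega)
    intro h; apply this; push_cast; linear_combination h
  · have := add_ne hg i (c := 1) (by omega) (by omega)
    intro h; apply this; push_cast; linear_combination h

theorem ahead_P (hg : 2 ≤ g) (i : Index g) : Ahead (S.V (i + 1)) (S.V i) (S.P i) := by
  have hv := S.left_vertex_mem (i + 1)
  rw [add_assoc, one_add_one_eq_two] at hv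
  have hsymm : ∀ {v a b}, v ∈ geodesic a b → v ∈ geodesic b a := by
    intro v a b h
    have : geodesicSide a b v = 0 := h
    change geodesicSide b a v = 0
    rw [geodesicSide_swap, this, neg_zero]
  refine ahead_of_geodesic hv (S.P_ne_Q hg i).symm (hsymm (S.right_vertex_mem i))
    (hsymm (S.left_vertex_mem i)) ?_ (S.ccw_P_Q_P hg i)
  have := S.geodesicSide_V_pos hg (j := i) (k := i + 1) ?_ ?_
  · rwa [add_assoc, one_add_one_eq_two] at this
  · have := add_ne hg i (c := 1) (by omega) (by omega)
    intro h; apply this; push_cast; exact h.symm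
  · have := add_ne hg i (c := 2) (by omega) (by omega)
    intro h; apply this; push_cast; linear_combination -h

theorem T_T (i : Index g) (x : Circle) : S.T (sigma i) • S.T i • x = x := by
  rw [← mul_smul]
  exact circle_smul_eq_of_disc (fun z => by rw [mul_smul, S.T_sigma]) x

theorem T_T' (hg : 2 ≤ g) (i : Index g) (x : Circle) : S.T i • S.T (sigma i) • x = x := by
  have := S.T_T (sigma i) x
  rwa [sigma_sigma hg] at this

theorem T_V_succ (hg : 2 ≤ g) (i : Index g) : S.T i • S.V (i + 1) = S.V (sigma i) := by
  have h := S.T_vertex (sigma i)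
  have h' := S.T_sigma (sigma i) (S.V (sigma i))
  rwa [h, rho, sigma_sigma hg] at h'

/-- `T i` takes `V i`, `V (i+1)` to `V (σ(i)+1)`, `V (σ(i))`, so it takes the ray along side `i`
towards `Q (i+1)` to the ray along side `σ(i)` towards `P (σ(i))`. -/
theorem T_Q_succ (hg : 2 ≤ g) (i : Index g) : S.T i • S.Q (i + 1) = S.P (sigma i) := by
  have h := (S.ahead_Q hg i).smul (S.T i)
  rw [T_V_succ S hg, S.T_vertex, rho] at h
  exact h.unique (S.ahead_P hg (sigma i))

theorem T_P (hg : 2 ≤ g) (i : Index g) : S.T i • S.P i = S.Q (sigma i + 1) := by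
  have h := S.T_Q_succ hg (sigma i)
  rw [sigma_sigma hg] at h
  rw [← h, T_T' S hg]

/-! ### Vertex angles and the extension condition -/

/-- The interior angle at the vertex `V i`, as a rotation. -/
noncomputable def angle (i : Index g) : Circle :=
  (center (S.V i) • S.P (i - 1)) / (center (S.V i) • S.Q (i + 1))

theorem angle_im_pos (hg : 2 ≤ g) (i : Index g) : 0 < (S.angle i : ℂ).im := by
  have h := S.ccw_P_Q_Q hg i
  have hne := S.P_ne_Q hg (i - 1)
  rw [sub_add_cancel] at hne
  have e := center_smul_right hne (S.V_mem i)
  rw [← ccw_smul (center (S.V i)), Ccw, e] at h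
  rw [angle, div_eq_mul_inv, Circle.coe_mul, Circle.coe_inv_eq_conj]
  simp only [Complex.mul_im, Complex.conj_re, Complex.conj_im,
    Complex.sub_re, Complex.sub_im, Complex.neg_re, Complex.neg_im] at h ⊢
  linarith

/-- The rotation by which `T i` acts on the directions at `V i`. -/
theorem exists_rotation_T (hg : 2 ≤ g) (i : Index g) : ∃ c : Circle,
    (∀ x : Circle, center (S.V (rho i)) • S.T i • x = c * center (S.V i) • x) ∧
    center (S.V (rho i)) • S.P (rho i - 1) = c * center (S.V i) • S.Q (i + 1) := by
  obtain ⟨c, h, -⟩ := exists_rotation (S.T i) (S.V i)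
  rw [S.T_vertex] at h
  refine ⟨c, h, ?_⟩
  rw [← h, T_Q_succ S hg, rho, add_sub_cancel_right]

/-- Each `T` turns the final direction of one angle into the initial direction of the next. The
product therefore telescopes to the product of the four rotations, which is 1 by the cycle relation.
-/
theorem angle_prod (hg : 2 ≤ g) (i : Index g) :
    S.angle (rho (rho (rho i))) * S.angle (rho (rho i)) * S.angle (rho i) * S.angle i = 1 := by
  obtain ⟨c₀, h₀, e₀⟩ := S.exists_rotation_T hg i
  obtain ⟨c₁, h₁, e₁⟩ := S.exists_rotation_T hg (rho i)
  obtain ⟨c₂, h₂, e₂⟩ := S.exists_rotation_T hg (rho (rho i))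
  obtain ⟨c₃, h₃, e₃⟩ := S.exists_rotation_T hg (rho (rho (rho i)))
  have hid : S.T (rho (rho (rho i))) • S.T (rho (rho i)) • S.T (rho i) • S.T i • (1 : Circle) =
      1 := by
    simp only [← mul_smul]
    exact circle_smul_eq_of_disc (fun z => by simpa only [mul_smul] using S.T_cycle i z) 1
  have hc : c₃ * (c₂ * (c₁ * c₀)) = 1 := by
    have h := h₃ (S.T (rho (rho i)) • S.T (rho i) • S.T i • 1)
    rw [hid, h₂, h₁, h₀, rho_four hg, ← mul_assoc, ← mul_assoc, ← mul_assoc] at h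
    rw [← mul_assoc, ← mul_assoc]
    exact mul_right_cancel (b := center (S.V i) • (1 : Circle)) (by rw [one_mul]; exact h.symm)
  rw [rho_four hg] at e₃
  rw [angle, angle, angle, angle, e₀, e₁, e₂, e₃, ← hc]
  apply Circle.ext
  simp only [Circle.coe_mul, Circle.coe_div]
  field_simp

theorem circle_eq_of_smul {M : SU11} {x y : Circle}
    (h : ((M • x : Circle) : ℂ) = (M • y : Circle)) : x = y :=
  MulAction.injective M (Circle.ext h)

theorem geodesicSide_diameter {A B : Circle} (h : (B : ℂ) = -A) (t : ℝ) (d : ℂ) :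
    geodesicSide A B (t * d) = -(4 * t) * (conj (A : ℂ) * d).im := by
  rw [geodesicSide, h]
  simp only [Complex.mul_im, Complex.mul_re, Complex.conj_re, Complex.conj_im, Complex.sub_re,
    Complex.sub_im, Complex.neg_re, Complex.neg_im, Complex.ofReal_re, Complex.ofReal_im]
  ring

theorem continuousAt_geodesicSide (M : SU11) (a b : Circle) (d : ℂ) :
    ContinuousAt (fun t : ℝ => geodesicSide a b (SU11.moebius M (t * d))) 0 := by
  have h0 := SU11.denom_ne_zero M (z := (0 : ℝ) * d) (by simp)
  have h1 : ContinuousAt (fun t : ℝ => SU11.moebius M (t * d)) 0 := by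
    unfold SU11.moebius
    exact ContinuousAt.div (by fun_prop) (by fun_prop) h0
  have h2 : Continuous (geodesicSide a b) := by
    unfold geodesicSide
    fun_prop
  exact h2.continuousAt.comp h1

/-- If the two angles had sum above `π`, the extension of side `j - 1` beyond `V j`, moved by `T j`,
would leave `V (rho j)` into the interior of the polygon. -/
theorem angle_mul_im_nonneg (hg : 2 ≤ g) (j : Index g) :
    0 ≤ (S.angle (rho j) * S.angle j : ℂ).im := by
  by_contra! hneg
  obtain ⟨c, hc, hp⟩ := S.exists_rotation_T hg j
  have hne := S.P_ne_Q hg (j - 1)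
  rw [sub_add_cancel] at hne
  have hne' := S.P_ne_Q hg (rho j - 1)
  rw [sub_add_cancel] at hne'
  set v := S.V (rho j) with hv
  -- the direction of the geodesic that extends the side before `j`
  have e1 := center_smul_right hne (S.V_mem j)
  have e2 := center_smul_right hne' (S.V_mem (rho j))
  have e3 := center_smul_right (S.P_ne_Q hg (rho j)) (S.left_vertex_mem (rho j))
  rw [← hv] at e2 e3
  have hPq : center v • S.P (rho j - 1) = S.angle (rho j) * center v • S.Q (rho j + 1) := by
    rw [angle, div_mul_cancel]
  have hd : ((center v • S.T j • S.Q j : Circle) : ℂ) =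
      -(S.angle j * (center v • S.P (rho j - 1) : Circle)) := by
    rw [hc, Circle.coe_mul, e1, hp, angle, div_eq_mul_inv, Circle.coe_mul, Circle.coe_mul,
      Circle.coe_inv]
    field_simp
  set d := center v • S.T j • S.Q j
  have ht : ∀ t : ℝ, 0 < t → t < 1 → ‖(t * d : ℂ)‖ < 1 := by
    intro t h0 h1
    rw [norm_mul, Circle.norm_coe, Complex.norm_real, Real.norm_of_nonneg h0.le, mul_one]
    exact h1
  have hw : ∀ (t : ℝ) (h : ‖(t * d : ℂ)‖ < 1),
      center v • (center v)⁻¹ • UnitDisc.mk (t * d : ℂ) h = UnitDisc.mk (t * d : ℂ) h :=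
    fun t h => smul_inv_smul _ _
  have hcoe : ∀ (t : ℝ) (h : ‖(t * d : ℂ)‖ < 1),
      (((center v)⁻¹ • UnitDisc.mk (t * d : ℂ) h : UnitDisc) : ℂ) =
        SU11.moebius (center v)⁻¹ (t * d) := fun t h => rfl
  have hev : ∀ k, ∀ᶠ t : ℝ in nhdsWithin 0 (Set.Ioi 0),
      0 < geodesicSide (S.P k) (S.Q (k + 1)) (SU11.moebius (center v)⁻¹ (t * d)) := by
    intro k
    -- Only the two sides through `v` need the direction `d`: for side `rho j` the sign is `hneg`,
    -- for side `rho j - 1` it is the sign of the angle at `j`. The other sides are strictly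
    -- positive at `v`, hence near it.
    by_cases h1 : k = rho j
    · filter_upwards [Ioo_mem_nhdsGT (zero_lt_one (α := ℝ))] with t ht'
      rw [← hcoe t (ht t ht'.1 ht'.2), ← geodesicSide_smul_pos (center v), hw, UnitDisc.coe_mk,
        h1, geodesicSide_diameter e3, hd, hPq, Circle.coe_mul, neg_eq_iff_eq_neg.1 e3.symm]
      have := circle_sq (center v • S.Q (rho j + 1))
      have e4 : (conj (-((center v • S.Q (rho j + 1) : Circle) : ℂ)) * -(S.angle j *
          (S.angle (rho j) * (center v • S.Q (rho j + 1) : Circle)))) =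
          S.angle (rho j) * S.angle j * (((center v • S.Q (rho j + 1) : Circle) : ℂ) *
            conj ((center v • S.Q (rho j + 1) : Circle) : ℂ)) := by
        rw [map_neg]; ring
      rw [e4, Complex.mul_conj, Circle.normSq_coe, Complex.ofReal_one, mul_one]
      nlinarith [ht'.1]
    by_cases h2 : k + 1 = rho j
    · filter_upwards [Ioo_mem_nhdsGT (zero_lt_one (α := ℝ))] with t ht'
      have h2' : k = rho j - 1 := eq_sub_of_add_eq h2
      rw [← hcoe t (ht t ht'.1 ht'.2), ← geodesicSide_smul_pos (center v), hw, UnitDisc.coe_mk,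
        h2, h2', geodesicSide_diameter e2, hd]
      have e4 : (conj ((center v • S.P (rho j - 1) : Circle) : ℂ) * -(S.angle j *
          (center v • S.P (rho j - 1) : Circle))) = -(S.angle j *
            (((center v • S.P (rho j - 1) : Circle) : ℂ) *
            conj ((center v • S.P (rho j - 1) : Circle) : ℂ))) := by
        ring
      rw [e4, Complex.mul_conj, Circle.normSq_coe, Complex.ofReal_one, mul_one, Complex.neg_im]
      nlinarith [ht'.1, S.angle_im_pos hg j]
    · have h3 : SU11.moebius (center v)⁻¹ ((0 : ℝ) * d) = v := by
        rw [Complex.ofReal_zero, zero_mul, ← UnitDisc.coe_zero, ← coe_smul_disc,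
          ← center_smul v, inv_smul_smul]
      have h4 := continuousAt_geodesicSide (center v)⁻¹ (S.P k) (S.Q (k + 1)) d
      refine (h4.eventually (lt_mem_nhds ?_)).filter_mono nhdsWithin_le_nhds
      change 0 < geodesicSide (S.P k) (S.Q (k + 1)) (SU11.moebius (center v)⁻¹ ((0 : ℝ) * d))
      rw [h3]
      exact S.geodesicSide_V_pos hg h1 h2
  have : NeZero (8 * g - 4) := ⟨by omega⟩
  obtain ⟨t, hin, ht0, ht1⟩ := ((Filter.eventually_all.2 hev).and
    (Ioo_mem_nhdsGT (zero_lt_one (α := ℝ)))).exists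
  set z : UnitDisc := (center v)⁻¹ • UnitDisc.mk (t * d : ℂ) (ht t ht0 ht1) with hz
  have hmem : (S.T j)⁻¹ ∈ Subgroup.closure (Set.range S.T) :=
    inv_mem (Subgroup.subset_closure ⟨j, rfl⟩)
  -- The point `z` is interior, while `(T j)⁻¹ • z` lies on the extension of side `j - 1`.
  apply S.extension _ hmem z hin (j - 1)
  rw [sub_add_cancel, ← smul_mem_geodesic (S.T j), smul_inv_smul, ← smul_mem_geodesic (center v),
    hz, hw]
  have e5 : (d : ℂ) = -(center v • S.T j • S.P (j - 1) : Circle) := by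
    simp only [d]
    rw [hc, hc, Circle.coe_mul, Circle.coe_mul, e1, mul_neg]
  change geodesicSide _ d (t * d) = 0
  rw [geodesicSide_diameter e5, neg_eq_iff_eq_neg.1 e5.symm, map_neg]
  simp only [Complex.mul_im, Complex.neg_re, Complex.neg_im, Complex.conj_re, Complex.conj_im]
  ring

/-- `b * a` and `d * c` are conjugate and both in the closed upper half plane, hence real. The value
1 would make `b` the conjugate of `a`, against the signs of their imaginary parts. -/
theorem eq_neg_one_of_im_nonneg {a b c d : Circle} (h : d * c * b * a = 1)
    (ha : 0 < (a : ℂ).im) (hb : 0 < (b : ℂ).im) (h1 : 0 ≤ (b * a : ℂ).im)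
    (h2 : 0 ≤ (d * c : ℂ).im) : (b * a : ℂ) = -1 := by
  have e : ((d * c)⁻¹ : Circle) = b * a := by
    rw [inv_eq_iff_mul_eq_one, ← mul_assoc, h]
  have e' := congrArg (fun x : Circle => (x : ℂ)) e
  simp only [Circle.coe_inv_eq_conj, Circle.coe_mul] at e'
  have hi : (b * a : ℂ).im = 0 := by
    have := congrArg Complex.im e'
    rw [Complex.conj_im] at this
    linarith
  have hs := circle_sq (b * a)
  rw [Circle.coe_mul, hi, mul_zero, add_zero] at hs
  have hr : (b * a : ℂ).re = -1 := by
    rcases mul_self_eq_one_iff.1 hs with h' | h'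
    · exfalso
      have : b * a = 1 := Circle.ext (by
        rw [Circle.coe_mul, Circle.coe_one]; exact Complex.ext h' (by rw [hi]; simp))
      have := inv_eq_of_mul_eq_one_left this
      rw [← this, Circle.coe_inv_eq_conj, Complex.conj_im] at hb
      linarith
    · exact h'
  exact Complex.ext (by rw [hr]; simp) (by rw [hi]; simp)

theorem angle_mul (hg : 2 ≤ g) (j : Index g) : (S.angle (rho j) * S.angle j : ℂ) = -1 :=
  eq_neg_one_of_im_nonneg (S.angle_prod hg j) (S.angle_im_pos hg _) (S.angle_im_pos hg _)
    (S.angle_mul_im_nonneg hg j) (S.angle_mul_im_nonneg hg (rho (rho j)))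

/-- As the angles at `V i` and `V (rho i)` add up to `π`, the image of the extended side `i - 1`
continues straight along side `rho i`. -/
theorem T_Q (hg : 2 ≤ g) (i : Index g) : S.T i • S.Q i = S.Q (sigma i + 2) := by
  obtain ⟨c, hc, hp⟩ := S.exists_rotation_T hg i
  have hne := S.P_ne_Q hg (i - 1)
  rw [sub_add_cancel] at hne
  have e1 := center_smul_right hne (S.V_mem i)
  have hPq : center (S.V (rho i)) • S.P (rho i - 1) =
      S.angle (rho i) * center (S.V (rho i)) • S.Q (rho i + 1) := by
    rw [angle, div_mul_cancel]
  have hPq' : center (S.V i) • S.P (i - 1) =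
      S.angle i * center (S.V i) • S.Q (i + 1) := by
    rw [angle, div_mul_cancel]
  have hr : sigma i + 2 = rho i + 1 := by rw [rho]; ring
  rw [hr]
  refine circle_eq_of_smul (M := center (S.V (rho i))) ?_
  rw [hc, Circle.coe_mul, e1, hPq', Circle.coe_mul]
  have h1 := congrArg (fun x : Circle => (x : ℂ)) hp
  simp only [hPq, Circle.coe_mul] at h1
  have h2 := S.angle_mul hg i
  linear_combination (S.angle i : ℂ) * h1 - (center (S.V (rho i)) • S.Q (rho i + 1) : Circle) * h2

theorem T_P_pred (hg : 2 ≤ g) (i : Index g) : S.T i • S.P (i - 1) = S.P (sigma i + 1) := by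
  obtain ⟨c, hc, -⟩ := S.exists_rotation_T hg i
  have hne := S.P_ne_Q hg (i - 1)
  rw [sub_add_cancel] at hne
  have e1 := center_smul_right hne (S.V_mem i)
  have e2 := center_smul_right (S.P_ne_Q hg (rho i)) (S.left_vertex_mem (rho i))
  have h := S.T_Q hg i
  have hr : sigma i + 2 = rho i + 1 := by rw [rho]; ring
  rw [hr] at h
  change _ = S.P (rho i)
  refine circle_eq_of_smul (M := center (S.V (rho i))) ?_
  have h1 := congrArg (fun x : Circle => (x : ℂ)) (hc (S.Q i))
  simp only [h, Circle.coe_mul, e1, e2] at h1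
  rw [hc, Circle.coe_mul]
  linear_combination h1

theorem T_P_succ (hg : 2 ≤ g) (i : Index g) : S.T i • S.P (i + 1) = S.P (sigma i - 1) := by
  have h := S.T_P_pred hg (sigma i)
  rw [sigma_sigma hg] at h
  rw [← h, T_T' S hg]

theorem T_Q_succ_succ (hg : 2 ≤ g) (i : Index g) : S.T i • S.Q (i + 2) = S.Q (sigma i) := by
  have h := S.T_Q hg (sigma i)
  rw [sigma_sigma hg] at h
  rw [← h, T_T' S hg]

end SurfacePolygon

/-! ### Half-open arcs -/

theorem mem_arcCO_split {a b c x : Circle} (h : Ccw a b c) (hx : x ∈ arcCO a c) :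
    x ∈ arcCO a b ∨ x ∈ arcCO b c := by
  rcases hx with ⟨rfl, -⟩ | hx
  · exact Or.inl (Or.inl ⟨rfl, h.ne₁₂⟩)
  by_cases hxb : x = b
  · exact Or.inr (Or.inl ⟨hxb, h.ne₂₃⟩)
  rcases ccw_or_ccw hx.ne₁₂ h.ne₁₂ hxb with h' | h'
  · exact Or.inl (Or.inr h')
  · exact Or.inr (Or.inr (h'.trans' hx))

theorem mem_arcCO_or {a b : Circle} (hab : a ≠ b) (x : Circle) :
    x ∈ arcCO a b ∨ x ∈ arcCO b a := by
  by_cases hxa : x = a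
  · exact Or.inl (Or.inl ⟨hxa, hab⟩)
  by_cases hxb : x = b
  · exact Or.inr (Or.inl ⟨hxb, hab.symm⟩)
  rcases ccw_or_ccw hab (Ne.symm hxa) (Ne.symm hxb) with h | h
  · exact Or.inr (Or.inr h.rotate)
  · exact Or.inl (Or.inr h)

theorem arcCO_subset_arc {a b : Circle} : arcCO a b ⊆ arc a b := by
  rintro x (⟨rfl, -⟩ | h)
  exacts [Or.inl rfl, Or.inr (Or.inr h)]

theorem mem_arc_of_mem_arcCO {a b x : Circle} (hx : x ∈ arc a b) (hab : a ≠ b) :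
    x ∈ arcCO a b ∨ x = b := by
  rcases hx with rfl | rfl | h
  exacts [Or.inl (Or.inl ⟨rfl, hab⟩), Or.inr rfl, Or.inl (Or.inr h)]

namespace SurfacePolygon

variable {g : ℕ} (S : SurfacePolygon g)

/-! ### Positions relative to the marked points -/

/-- `x` is the marked point `p / 2` if `p` is even, and lies strictly between the marked points
`p / 2` and `p / 2 + 1` if `p` is odd. -/
def Loc (x : Circle) (p : ℤ) : Prop :=
  (∃ a, p = 2 * a ∧ x = S.mark a) ∨ ∃ a, p = 2 * a + 1 ∧ Ccw (S.mark a) x (S.mark (a + 1))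

theorem loc_mark (a : ℤ) : S.Loc (S.mark a) (2 * a) := Or.inl ⟨a, rfl, rfl⟩

variable {S}

theorem Loc.shift (hg : 2 ≤ g) {x : Circle} {p : ℤ} (h : S.Loc x p) (t : ℤ) :
    S.Loc x (p + 4 * (8 * g - 4) * t) := by
  rcases h with ⟨a, rfl, h⟩ | ⟨a, rfl, h⟩
  · exact Or.inl ⟨a + 2 * (8 * g - 4) * t, by ring, by rw [S.mark_add_period hg, h]⟩
  · refine Or.inr ⟨a + 2 * (8 * g - 4) * t, by ring, ?_⟩
    rw [S.mark_add_period hg, add_right_comm, S.mark_add_period hg]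
    exact h

theorem Loc.ccw (hg : 2 ≤ g) {x : Circle} {p a b : ℤ} (h : S.Loc x p) (ha : 2 * a < p)
    (hb : p < 2 * b) (hab : b < a + 2 * (8 * g - 4)) : Ccw (S.mark a) x (S.mark b) := by
  rcases h with ⟨k, rfl, rfl⟩ | ⟨k, rfl, h⟩
  · exact S.mark_ccw hg (by omega) (by omega) hab
  have h1 : Ccw (S.mark a) x (S.mark (k + 1)) := by
    rcases (show a ≤ k by omega).eq_or_lt with rfl | hak
    · exact h
    · have := (S.mark_ccw hg hak (show k < k + 1 by omega) (by omega)).rotate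
      exact (h.trans' this).rotate.rotate
  rcases (show k + 1 ≤ b by omega).eq_or_lt with rfl | hkb
  · exact h1
  · exact h1.trans (S.mark_ccw hg (by omega) hkb hab)

theorem Loc.mem_arcCO (hg : 2 ≤ g) {x : Circle} {p a b : ℤ} (h : S.Loc x p) (ha : 2 * a ≤ p)
    (hb : p < 2 * b) (hab : b < a + 2 * (8 * g - 4)) : x ∈ arcCO (S.mark a) (S.mark b) := by
  rcases ha.eq_or_lt with rfl | ha'
  · rcases h with ⟨k, hk, rfl⟩ | ⟨k, hk, -⟩
    · obtain rfl : a = k := by omega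
      exact Or.inl ⟨rfl, S.mark_ne hg (by omega) hab⟩
    · omega
  · exact Or.inr (h.ccw hg ha' hb hab)

theorem Loc.mem_arc (hg : 2 ≤ g) {x : Circle} {p a b : ℤ} (h : S.Loc x p) (ha : 2 * a ≤ p)
    (hb : p ≤ 2 * b) (hab : b < a + 2 * (8 * g - 4)) : x ∈ arc (S.mark a) (S.mark b) := by
  rcases hb.eq_or_lt with rfl | hb'
  · rcases h with ⟨k, hk, rfl⟩ | ⟨k, hk, -⟩
    · obtain rfl : b = k := by omega
      exact Or.inr (Or.inl rfl)
    · omega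
  · exact arcCO_subset_arc (h.mem_arcCO hg ha hb' hab)

theorem exists_loc_of_mem_arcCO (hg : 2 ≤ g) {x : Circle} {a b : ℤ} (h : a < b)
    (hab : b < a + 2 * (8 * g - 4)) (hx : x ∈ arcCO (S.mark a) (S.mark b)) :
    ∃ p, S.Loc x p ∧ 2 * a ≤ p ∧ p < 2 * b := by
  obtain ⟨m, rfl⟩ : ∃ m : ℕ, b = a + 1 + m := ⟨(b - a - 1).toNat, by omega⟩
  clear h
  induction m with
  | zero =>
    rw [Nat.cast_zero, add_zero] at hx ⊢
    rcases hx with ⟨rfl, -⟩ | hx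
    · exact ⟨2 * a, S.loc_mark a, by omega, by omega⟩
    · exact ⟨2 * a + 1, Or.inr ⟨a, rfl, hx⟩, by omega, by omega⟩
  | succ m ih =>
    push_cast at hab hx ⊢
    have h := S.mark_ccw hg (a := a) (b := a + 1 + m) (c := a + 1 + (m + 1)) (by omega) (by omega)
      (by omega)
    rcases mem_arcCO_split h hx with hx' | hx'
    · obtain ⟨p, hp, h1, h2⟩ := ih (by omega) hx'
      exact ⟨p, hp, h1, by omega⟩
    · rcases hx' with ⟨rfl, -⟩ | hx'
      · exact ⟨2 * (a + 1 + m), S.loc_mark _, by omega, by omega⟩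
      · exact ⟨2 * (a + 1 + m) + 1, Or.inr ⟨a + 1 + m, rfl, by rwa [add_assoc (a + 1)]⟩, by omega,
          by omega⟩

theorem exists_loc_of_mem_arc (hg : 2 ≤ g) {x : Circle} {a b : ℤ} (h : a < b)
    (hab : b < a + 2 * (8 * g - 4)) (hx : x ∈ arc (S.mark a) (S.mark b)) :
    ∃ p, S.Loc x p ∧ 2 * a ≤ p ∧ p ≤ 2 * b := by
  rcases mem_arc_of_mem_arcCO hx (S.mark_ne hg h hab) with hx | rfl
  · obtain ⟨p, hp, h1, h2⟩ := exists_loc_of_mem_arcCO hg h hab hx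
    exact ⟨p, hp, h1, h2.le⟩
  · exact ⟨_, S.loc_mark b, by omega, le_rfl⟩

variable (S) in
theorem exists_loc (hg : 2 ≤ g) (x : Circle) : ∃ p, S.Loc x p := by
  have hne := S.mark_ne hg (a := 0) (b := 1) (by omega) (by omega)
  rcases mem_arcCO_or hne x with h | h
  · obtain ⟨p, hp, -⟩ := exists_loc_of_mem_arcCO hg (by omega) (by omega) h
    exact ⟨p, hp⟩
  · rw [← S.mark_add_period hg 0 1] at h
    obtain ⟨p, hp, -⟩ := exists_loc_of_mem_arcCO hg (by omega) (by omega) h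
    exact ⟨p, hp⟩

/-- A second position less than a period ahead would put `x` strictly inside an arc of marks that
its first position excludes. -/
theorem Loc.not_between (hg : 2 ≤ g) {x : Circle} {p q : ℤ} (hp : S.Loc x p) (hq : S.Loc x q)
    (h : p < q) : p + 4 * (8 * g - 4) ≤ q := by
  by_contra! h'
  have per : ∀ a, S.mark (a + 2 * (8 * g - 4)) = S.mark a := fun a => by
    simpa using S.mark_add_period hg a 1
  rcases hp with ⟨a, rfl, rfl⟩ | ⟨a, rfl, h1⟩
  · by_cases h2 : q < 2 * (a + 2)
    · exact (hq.ccw hg h h2 (by omega)).ne₁₂ rfl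
    · have := hq.ccw hg (a := a + 1) (b := a + 2 * (8 * g - 4)) (by omega) (by omega) (by omega)
      rw [per] at this
      exact this.ne₂₃ rfl
  · by_cases h2 : q = 2 * (a + 1)
    · subst h2
      rcases hq with ⟨b, hb, rfl⟩ | ⟨b, hb, -⟩
      · obtain rfl : a + 1 = b := by omega
        exact h1.ne₂₃ rfl
      · omega
    by_cases h3 : q = 2 * (a + 2 * (8 * g - 4))
    · rcases hq with ⟨b, hb, rfl⟩ | ⟨b, hb, -⟩
      · obtain rfl : a + 2 * (8 * g - 4) = b := by omega
        rw [per] at h1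
        exact h1.ne₁₂ rfl
      · omega
    · have := hq.ccw hg (a := a + 1) (b := a + 2 * (8 * g - 4)) (by omega) (by omega) (by omega)
      rw [per] at this
      exact this.rotate.rotate.not_swap h1

/-- Four positions per label (`P k` at `4k`, `Q k` at `4k + 2`, the gaps at odd numbers) give the
period `4(8g - 4)`. Statements about arcs thus become linear inequalities over the integers. -/
theorem Loc.unique (hg : 2 ≤ g) {x : Circle} {p q : ℤ} (hp : S.Loc x p) (hq : S.Loc x q) :
    ∃ t : ℤ, q = p + 4 * (8 * g - 4) * t := by
  have hN : (0 : ℤ) < 4 * (8 * g - 4) := by omega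
  refine ⟨(q - p) / (4 * (8 * g - 4)), ?_⟩
  have h1 := hp.shift hg ((q - p) / (4 * (8 * g - 4)))
  have h2 := Int.emod_add_mul_ediv (q - p) (4 * (8 * g - 4))
  have h3 := Int.emod_nonneg (q - p) hN.ne'
  have h4 := Int.emod_lt_of_pos (q - p) hN
  rcases h3.eq_or_lt with h5 | h5
  · omega
  · have := h1.not_between hg hq (by omega)
    omega

end SurfacePolygon

namespace SurfacePolygon

variable {g : ℕ} (S : SurfacePolygon g)

/-! ### Admissible extremal parameters and their domains -/

/-- A choice of extremal parameters (`0` stands for `P i`, `1` for `Q i`) for which the solution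
`G` of the system of equations consists of marked points. -/
structure IsType (e : Index g → ℤ) : Prop where
  zero_or_one : ∀ i, e i = 0 ∨ e i = 1
  add_four : ∀ i, e (i + 4) = e i

/-- The type of the dual parameters. -/
def dualType (e : Index g → ℤ) (i : Index g) : ℤ := 1 - e (i + 2)

/-- The extremal parameters of type `e`. -/
def param (e : Index g → ℤ) (i : Index g) : Circle := if e i = 0 then S.P i else S.Q i

/-- The section of the domain over `[P i, Q i]`. -/
def sectionPQ (e : Index g → ℤ) (i : Index g) : Set Circle :=
  arc (S.Q (i + 2 - (e i : Index g))) (S.P (i - 1 - (e i : Index g)))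

/-- The section of the domain over `[Q i, P (i+1)]`. -/
def sectionQP (e : Index g → ℤ) (i : Index g) : Set Circle :=
  arc (S.Q (i + 2 - (e i : Index g))) (S.P (i - (e (i + 1) : Index g)))

/-- The domain. -/
def dom (e : Index g → ℤ) : Set (Circle × Circle) :=
  {p | ∃ i, (p.1 ∈ S.sectionPQ e i ∧ p.2 ∈ arc (S.P i) (S.Q i)) ∨
    (p.1 ∈ S.sectionQP e i ∧ p.2 ∈ arc (S.Q i) (S.P (i + 1)))}

/-- The domain without its upper horizontal edges. -/
def domCO (e : Index g → ℤ) : Set (Circle × Circle) :=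
  {p | ∃ i, (p.1 ∈ S.sectionPQ e i ∧ p.2 ∈ arcCO (S.P i) (S.Q i)) ∨
    (p.1 ∈ S.sectionQP e i ∧ p.2 ∈ arcCO (S.Q i) (S.P (i + 1)))}

/-- The part of `domCO e` over `[A i, A (i+1))`. -/
def strip (e : Index g → ℤ) (i : Index g) : Set (Circle × Circle) :=
  {p | (e i = 0 ∧ p.1 ∈ S.sectionPQ e i ∧ p.2 ∈ arcCO (S.P i) (S.Q i)) ∨
    (p.1 ∈ S.sectionQP e i ∧ p.2 ∈ arcCO (S.Q i) (S.P (i + 1))) ∨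
    (e (i + 1) = 1 ∧ p.1 ∈ S.sectionPQ e (i + 1) ∧ p.2 ∈ arcCO (S.P (i + 1)) (S.Q (i + 1)))}

/-- The part of `domCO e` over the vertical strip `[D s, D (s+1)]`. -/
def imageStrip (d : Index g → ℤ) (s : Index g) : Set (Circle × Circle) :=
  {p | (p.1 ∈ arc (S.param d s) (S.param d (s + 1)) ∧
      p.2 ∈ arcCO (S.Q (s + 2)) (S.P (s - 1))) ∨
    (d s = 1 ∧ p.1 ∈ arc (S.Q s) (S.P (s + 1)) ∧ p.2 ∈ arcCO (S.Q (s + 1)) (S.Q (s + 2))) ∨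
    (d (s + 1) = 0 ∧ p.1 ∈ arc (S.Q s) (S.P (s + 1)) ∧ p.2 ∈ arcCO (S.P (s - 1)) (S.P s))}

variable {S}

theorem P_intCast (k : ℤ) : S.P k = S.mark (2 * k) := (S.mark_P k).symm

theorem Q_intCast (k : ℤ) : S.Q k = S.mark (2 * k + 1) := (S.mark_Q k).symm

theorem mark_sub_period (hg : 2 ≤ g) (k : ℤ) : S.mark k = S.mark (k + 2 * (8 * g - 4)) := by
  simpa using (S.mark_add_period hg k 1).symm

theorem param_intCast {e : Index g → ℤ} (he : IsType e) (k : ℤ) :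
    S.param e k = S.mark (2 * k + e k) := by
  rcases he.zero_or_one k with h | h
  · rw [param, if_pos h, h, add_zero, P_intCast]
  · rw [param, if_neg (by omega), h, Q_intCast]

theorem sectionPQ_intCast (hg : 2 ≤ g) (e : Index g → ℤ) (k : ℤ) :
    S.sectionPQ e k = arc (S.mark (2 * (k + 2 - e k) + 1))
      (S.mark (2 * (k - 1 - e k) + 2 * (8 * g - 4))) := by
  rw [sectionPQ, ← mark_sub_period hg, mark_P, mark_Q]
  push_cast
  rfl

theorem sectionQP_intCast (hg : 2 ≤ g) (e : Index g → ℤ) (k : ℤ) :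
    S.sectionQP e k = arc (S.mark (2 * (k + 2 - e k) + 1))
      (S.mark (2 * (k - e (k + 1)) + 2 * (8 * g - 4))) := by
  rw [sectionQP, ← mark_sub_period hg, mark_P, mark_Q]
  push_cast
  rfl

theorem IsType.bounds {e : Index g → ℤ} (he : IsType e) (i : Index g) : 0 ≤ e i ∧ e i ≤ 1 := by
  rcases he.zero_or_one i with h | h <;> omega

theorem IsType.eq_of_mod {e : Index g → ℤ} (he : IsType e) {a b : ℤ} (h : (b - a) % 4 = 0) :
    e (b : Index g) = e a := by
  obtain ⟨t, ht⟩ := Int.dvd_of_emod_eq_zero h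
  obtain rfl : b = a + 4 * t := by omega
  clear h ht
  induction t using Int.induction_on with
  | zero => simp
  | succ t ih => rw [← ih, ← he.add_four (a + 4 * t : ℤ)]; congr 1; push_cast; ring
  | pred t ih => rw [← ih, ← he.add_four (a + 4 * (-t - 1) : ℤ)]; congr 1; push_cast; ring

/-- For either parity `σ(i)` is `i + 2` modulo 4. -/
theorem IsType.sigma (hg : 2 ≤ g) {e : Index g → ℤ} (he : IsType e) (i : Index g) :
    e (sigma i) = e (i + 2) := by
  obtain ⟨k, rfl⟩ := exists_intCast i
  by_cases hk : Even k
  · rw [sigma_even hg hk, he.eq_of_mod (a := k + 2) (by grind)]; push_cast; rfl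
  · rw [sigma_odd hg hk, he.eq_of_mod (a := k + 2) (by grind)]; push_cast; rfl

theorem dualType_dualType {e : Index g → ℤ} (he : IsType e) : dualType (dualType e) = e := by
  funext i
  rw [dualType, dualType, sub_sub_cancel, add_assoc]
  norm_num
  exact he.add_four i

theorem IsType.dual {e : Index g → ℤ} (he : IsType e) : IsType (dualType e) where
  zero_or_one i := by rcases he.zero_or_one (i + 2) with h | h <;> simp [dualType, h]
  add_four i := by rw [dualType, dualType, add_right_comm, he.add_four]

theorem dualType_of_mod {e : Index g → ℤ} (he : IsType e) {a b : ℤ} (h : (b - a) % 4 = 2) :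
    e (b : Index g) = 1 - dualType e a := by
  rw [dualType, sub_sub_cancel]
  have := he.eq_of_mod (a := a + 2) (b := b) (by omega)
  rw [this]; push_cast; rfl

theorem mem_arc_iff (hg : 2 ≤ g) {x : Circle} {a b : ℤ} (h : a < b)
    (hab : b < a + 2 * (8 * g - 4)) :
    x ∈ arc (S.mark a) (S.mark b) ↔ ∃ p, S.Loc x p ∧ 2 * a ≤ p ∧ p ≤ 2 * b :=
  ⟨exists_loc_of_mem_arc hg h hab, fun ⟨_, hp, h1, h2⟩ => hp.mem_arc hg h1 h2 hab⟩

theorem mem_arcCO_iff (hg : 2 ≤ g) {x : Circle} {a b : ℤ} (h : a < b)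
    (hab : b < a + 2 * (8 * g - 4)) :
    x ∈ arcCO (S.mark a) (S.mark b) ↔ ∃ p, S.Loc x p ∧ 2 * a ≤ p ∧ p < 2 * b :=
  ⟨exists_loc_of_mem_arcCO hg h hab, fun ⟨_, hp, h1, h2⟩ => hp.mem_arcCO hg h1 h2 hab⟩

theorem mem_sectionPQ_iff (hg : 2 ≤ g) {e : Index g → ℤ} (he : IsType e) {x : Circle} (k : ℤ) :
    x ∈ S.sectionPQ e k ↔ ∃ p, S.Loc x p ∧ 4 * k + 10 - 4 * e k ≤ p ∧
      p ≤ 4 * k - 4 - 4 * e k + 4 * (8 * g - 4) := by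
  have := he.bounds (k : Index g)
  rw [sectionPQ_intCast hg, mem_arc_iff hg (by omega) (by omega)]
  refine exists_congr fun p => and_congr_right fun _ => ?_
  omega

theorem mem_sectionQP_iff (hg : 2 ≤ g) {e : Index g → ℤ} (he : IsType e) {x : Circle} (k : ℤ) :
    x ∈ S.sectionQP e k ↔ ∃ p, S.Loc x p ∧ 4 * k + 10 - 4 * e k ≤ p ∧
      p ≤ 4 * k - 4 * e (k + 1 : ℤ) + 4 * (8 * g - 4) := by
  have := he.bounds (k : Index g)
  have := he.bounds (k + 1 : ℤ)
  push_cast at this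
  rw [sectionQP_intCast hg, mem_arc_iff hg (by omega) (by omega)]
  push_cast
  refine exists_congr fun p => and_congr_right fun _ => ?_
  omega

theorem P_add_one (k : ℤ) : S.P ((k : Index g) + 1) = S.mark (2 * (k + 1)) := by
  rw [mark_P]; push_cast; rfl

theorem mem_domCO_iff (hg : 2 ≤ g) {e : Index g → ℤ} (he : IsType e) {u w : Circle} :
    (u, w) ∈ S.domCO e ↔ ∃ j p q : ℤ, S.Loc u p ∧ S.Loc w q ∧
      4 * j + 10 - 4 * e j ≤ p ∧ 4 * j ≤ q ∧ q < 4 * j + 4 ∧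
      ((q < 4 * j + 2 ∧ p ≤ 4 * j - 4 - 4 * e j + 4 * (8 * g - 4)) ∨
        (4 * j + 2 ≤ q ∧ p ≤ 4 * j - 4 * e (j + 1 : ℤ) + 4 * (8 * g - 4))) := by
  constructor
  · rintro ⟨i, h⟩
    obtain ⟨j, rfl⟩ := exists_intCast i
    rw [P_add_one, P_intCast, Q_intCast, mem_sectionPQ_iff hg he, mem_sectionQP_iff hg he,
      mem_arcCO_iff hg (by omega) (by omega), mem_arcCO_iff hg (by omega) (by omega)] at h
    rcases h with ⟨⟨p, hp, h1, h2⟩, q, hq, h3, h4⟩ | ⟨⟨p, hp, h1, h2⟩, q, hq, h3, h4⟩ <;>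
      exact ⟨j, p, q, hp, hq, by omega, by omega, by omega, by omega⟩
  · rintro ⟨j, p, q, hp, hq, h1, h2, h3, h4⟩
    refine ⟨j, ?_⟩
    rw [P_add_one, P_intCast, Q_intCast, mem_sectionPQ_iff hg he, mem_sectionQP_iff hg he,
      mem_arcCO_iff hg (by omega) (by omega), mem_arcCO_iff hg (by omega) (by omega)]
    rcases h4 with ⟨h4, h5⟩ | ⟨h4, h5⟩
    · exact Or.inl ⟨⟨p, hp, h1, h5⟩, q, hq, by omega, by omega⟩
    · exact Or.inr ⟨⟨p, hp, h1, h5⟩, q, hq, by omega, by omega⟩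

theorem mem_dom_iff (hg : 2 ≤ g) {e : Index g → ℤ} (he : IsType e) {u w : Circle} :
    (u, w) ∈ S.dom e ↔ ∃ j p q : ℤ, S.Loc u p ∧ S.Loc w q ∧
      4 * j + 10 - 4 * e j ≤ p ∧ 4 * j ≤ q ∧ q ≤ 4 * j + 4 ∧
      ((q ≤ 4 * j + 2 ∧ p ≤ 4 * j - 4 - 4 * e j + 4 * (8 * g - 4)) ∨
        (4 * j + 2 ≤ q ∧ p ≤ 4 * j - 4 * e (j + 1 : ℤ) + 4 * (8 * g - 4))) := by
  constructor
  · rintro ⟨i, h⟩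
    obtain ⟨j, rfl⟩ := exists_intCast i
    rw [P_add_one, P_intCast, Q_intCast, mem_sectionPQ_iff hg he, mem_sectionQP_iff hg he,
      mem_arc_iff hg (by omega) (by omega), mem_arc_iff hg (by omega) (by omega)] at h
    rcases h with ⟨⟨p, hp, h1, h2⟩, q, hq, h3, h4⟩ | ⟨⟨p, hp, h1, h2⟩, q, hq, h3, h4⟩ <;>
      exact ⟨j, p, q, hp, hq, by omega, by omega, by omega, by omega⟩
  · rintro ⟨j, p, q, hp, hq, h1, h2, h3, h4⟩
    refine ⟨j, ?_⟩
    rw [P_add_one, P_intCast, Q_intCast, mem_sectionPQ_iff hg he, mem_sectionQP_iff hg he,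
      mem_arc_iff hg (by omega) (by omega), mem_arc_iff hg (by omega) (by omega)]
    rcases h4 with ⟨h4, h5⟩ | ⟨h4, h5⟩
    · exact Or.inl ⟨⟨p, hp, h1, h5⟩, q, hq, by omega, by omega⟩
    · exact Or.inr ⟨⟨p, hp, h1, h5⟩, q, hq, by omega, by omega⟩

theorem mem_strip_iff (hg : 2 ≤ g) {e : Index g → ℤ} (he : IsType e) {u w : Circle} (i : ℤ) :
    (u, w) ∈ S.strip e i ↔ ∃ p q : ℤ, S.Loc u p ∧ S.Loc w q ∧
      4 * i + 10 - 4 * e i ≤ p ∧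
      ((e i = 0 ∧ 4 * i ≤ q ∧ q < 4 * i + 2 ∧ p ≤ 4 * i - 4 - 4 * e i + 4 * (8 * g - 4)) ∨
        (4 * i + 2 ≤ q ∧ q < 4 * i + 4 ∧ p ≤ 4 * i - 4 * e (i + 1 : ℤ) + 4 * (8 * g - 4)) ∨
        (e (i + 1 : ℤ) = 1 ∧ 4 * i + 4 ≤ q ∧ q < 4 * i + 6 ∧ 4 * i + 10 ≤ p ∧
          p ≤ 4 * i - 4 + 4 * (8 * g - 4))) := by
  have hb := he.bounds (i : Index g)
  have e1 : e ((i : Index g) + 1) = e (i + 1 : ℤ) := by push_cast; rfl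
  have e2 : S.sectionPQ e ((i : Index g) + 1) = S.sectionPQ e (i + 1 : ℤ) := by push_cast; rfl
  have e3 : S.Q ((i : Index g) + 1) = S.mark (2 * (i + 1) + 1) := by rw [mark_Q]; push_cast; rfl
  simp only [strip, Set.mem_ofPred_eq]
  rw [e1, e2, e3, P_add_one, P_intCast, Q_intCast, mem_sectionPQ_iff hg he,
    mem_sectionQP_iff hg he, mem_sectionPQ_iff hg he,
    mem_arcCO_iff hg (by omega) (by omega), mem_arcCO_iff hg (by omega) (by omega),
    mem_arcCO_iff hg (by omega) (by omega)]
  constructor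
  · rintro (⟨h0, ⟨p, hp, h1, h2⟩, q, hq, h3, h4⟩ | ⟨⟨p, hp, h1, h2⟩, q, hq, h3, h4⟩ |
      ⟨h0, ⟨p, hp, h1, h2⟩, q, hq, h3, h4⟩)
    · exact ⟨p, q, hp, hq, h1, Or.inl ⟨h0, by omega, by omega, h2⟩⟩
    · exact ⟨p, q, hp, hq, h1, Or.inr (Or.inl ⟨by omega, by omega, h2⟩)⟩
    · exact ⟨p, q, hp, hq, by omega, Or.inr (Or.inr ⟨h0, by omega, by omega, by omega, by omega⟩)⟩
  · rintro ⟨p, q, hp, hq, h1, ⟨h0, h3, h4, h2⟩ | ⟨h3, h4, h2⟩ | ⟨h0, h3, h4, h5, h2⟩⟩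
    · exact Or.inl ⟨h0, ⟨p, hp, h1, h2⟩, q, hq, by omega, by omega⟩
    · exact Or.inr (Or.inl ⟨⟨p, hp, h1, h2⟩, q, hq, by omega, by omega⟩)
    · exact Or.inr (Or.inr ⟨h0, ⟨p, hp, by omega, by omega⟩, q, hq, by omega, by omega⟩)

theorem mem_imageStrip_iff (hg : 2 ≤ g) {d : Index g → ℤ} (hd : IsType d) {u w : Circle} (s : ℤ) :
    (u, w) ∈ S.imageStrip d s ↔ ∃ p q : ℤ, S.Loc u p ∧ S.Loc w q ∧
      4 * s + 2 * d s ≤ p ∧ p ≤ 4 * s + 4 + 2 * d (s + 1 : ℤ) ∧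
      ((4 * s + 10 ≤ q ∧ q < 4 * s - 4 + 4 * (8 * g - 4)) ∨
        (d s = 1 ∧ 4 * s + 6 ≤ q ∧ q < 4 * s + 10 ∧ p ≤ 4 * s + 4) ∨
        (d (s + 1 : ℤ) = 0 ∧ 4 * s - 4 + 4 * (8 * g - 4) ≤ q ∧ q < 4 * s + 4 * (8 * g - 4) ∧
          4 * s + 2 ≤ p)) := by
  have hb := hd.bounds (s : Index g)
  have hb' := hd.bounds (s + 1 : ℤ)
  have e1 : d ((s : Index g) + 1) = d (s + 1 : ℤ) := by push_cast; rfl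
  have e2 : S.param d ((s : Index g) + 1) = S.param d (s + 1 : ℤ) := by push_cast; rfl
  have e3 : S.Q ((s : Index g) + 1) = S.mark (2 * (s + 1) + 1) := by rw [mark_Q]; push_cast; rfl
  have e4 : S.Q ((s : Index g) + 2) = S.mark (2 * (s + 2) + 1) := by rw [mark_Q]; push_cast; rfl
  have e5 : S.P ((s : Index g) - 1) = S.mark (2 * (s - 1) + 2 * (8 * g - 4)) := by
    rw [← mark_sub_period hg, mark_P]; push_cast; rfl
  have e6 : S.P (s : Index g) = S.mark (2 * s + 2 * (8 * g - 4)) := by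
    rw [← mark_sub_period hg, mark_P]
  simp only [imageStrip, Set.mem_ofPred_eq]
  rw [e1, e2, e3, e4, e5, e6, P_add_one, Q_intCast, param_intCast hd, param_intCast hd,
    mem_arc_iff hg (by omega) (by omega), mem_arc_iff hg (by omega) (by omega),
    mem_arcCO_iff hg (by omega) (by omega), mem_arcCO_iff hg (by omega) (by omega),
    mem_arcCO_iff hg (by omega) (by omega)]
  constructor
  · rintro (⟨⟨p, hp, h1, h2⟩, q, hq, h3, h4⟩ | ⟨h0, ⟨p, hp, h1, h2⟩, q, hq, h3, h4⟩ |
      ⟨h0, ⟨p, hp, h1, h2⟩, q, hq, h3, h4⟩)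
    · exact ⟨p, q, hp, hq, by omega, by omega, Or.inl ⟨by omega, by omega⟩⟩
    · exact ⟨p, q, hp, hq, by omega, by omega,
        Or.inr (Or.inl ⟨h0, by omega, by omega, by omega⟩)⟩
    · exact ⟨p, q, hp, hq, by omega, by omega,
        Or.inr (Or.inr ⟨h0, by omega, by omega, by omega⟩)⟩
  · rintro ⟨p, q, hp, hq, h1, h2, ⟨h3, h4⟩ | ⟨h0, h3, h4, h5⟩ | ⟨h0, h3, h4, h5⟩⟩
    · exact Or.inl ⟨⟨p, hp, by omega, by omega⟩, q, hq, by omega, by omega⟩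
    · exact Or.inr (Or.inl ⟨h0, ⟨p, hp, by omega, by omega⟩, q, hq, by omega, by omega⟩)
    · exact Or.inr (Or.inr ⟨h0, ⟨p, hp, by omega, by omega⟩, q, hq, by omega, by omega⟩)

/-! ### Horizontal cells against vertical strips, and the exchange of coordinates -/

/-- The relations between a type and its dual at the corners of the domain. -/
theorem IsType.corners {e : Index g → ℤ} (he : IsType e) (j m : ℤ) :
    (j = m - 2 → e j = 1 - dualType e m) ∧
    (j = m - 1 → e j = 1 - dualType e (m + 1 : ℤ)) ∧
    (j = m - (8 * g - 4) → e (j + 1 : ℤ) = 1 - dualType e (m - 1 : ℤ)) ∧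
    (j = m - (8 * g - 4) + 1 → e j = 1 - dualType e (m - 1 : ℤ)) ∧
    (j = m - (8 * g - 4) + 1 → e (j + 1 : ℤ) = 1 - dualType e m) ∧
    (j = m - (8 * g - 4) + 2 → e j = 1 - dualType e m) ∧
    (j = m - (8 * g - 4) + 2 → e (j + 1 : ℤ) = 1 - dualType e (m + 1 : ℤ)) := by
  refine ⟨fun h => ?_, fun h => ?_, fun h => ?_, fun h => ?_, fun h => ?_, fun h => ?_,
    fun h => ?_⟩ <;> exact dualType_of_mod he (by omega)

theorem imageStrip_subset (hg : 2 ≤ g) {e : Index g → ℤ} (he : IsType e) (s : Index g) :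
    S.imageStrip (dualType e) s ⊆ S.domCO e := by
  rintro ⟨u, w⟩ h
  obtain ⟨s, rfl⟩ := exists_intCast s
  rw [mem_imageStrip_iff hg he.dual] at h
  obtain ⟨p, q, hp, hq, h1, h2, h3⟩ := h
  -- Vertical strips place `w` ahead of `u`, horizontal cells place `u` ahead of `w`; a shift by one
  -- period converts one form into the other.
  have hp' := hp.shift hg 1
  rw [mul_one] at hp'
  rw [mem_domCO_iff hg he]
  refine ⟨q / 4, _, q, hp', hq, ?_⟩
  have b1 := he.dual.bounds (s : Index g)
  have b2 := he.dual.bounds (s + 1 : ℤ)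
  have b3 := he.bounds (q / 4 : ℤ)
  have b4 := he.bounds (q / 4 + 1 : ℤ)
  -- The values of `e` and of its dual meet only where labels differ by 2 modulo 4. The period is
  -- divisible by 4 and does not disturb this.
  have f1 : (q / 4 - s) % 4 = 2 → e (q / 4 : ℤ) = 1 - dualType e s := dualType_of_mod he
  have f2 : (q / 4 - (s + 1)) % 4 = 2 → e (q / 4 : ℤ) = 1 - dualType e (s + 1 : ℤ) :=
    dualType_of_mod he
  have f3 : (q / 4 + 1 - (s + 1)) % 4 = 2 → e (q / 4 + 1 : ℤ) = 1 - dualType e (s + 1 : ℤ) :=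
    dualType_of_mod he
  have f4 : (q / 4 + 1 - s) % 4 = 2 → e (q / 4 + 1 : ℤ) = 1 - dualType e s :=
    dualType_of_mod he
  generalize e (q / 4 : ℤ) = E0 at *
  generalize e (q / 4 + 1 : ℤ) = E1 at *
  generalize dualType e (s : ℤ) = D0 at *
  generalize dualType e (s + 1 : ℤ) = D1 at *
  omega

theorem mem_imageStrip_of_loc (hg : 2 ≤ g) {e : Index g → ℤ} (he : IsType e) {u w : Circle}
    {j p q s : ℤ} (hp : S.Loc u p) (hq : S.Loc w q) (h1 : 4 * j + 10 - 4 * e j ≤ p)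
    (h2 : 4 * j ≤ q) (h3 : q < 4 * j + 4)
    (h4 : (q < 4 * j + 2 ∧ p ≤ 4 * j - 4 - 4 * e j + 4 * (8 * g - 4)) ∨
        (4 * j + 2 ≤ q ∧ p ≤ 4 * j - 4 * e (j + 1 : ℤ) + 4 * (8 * g - 4)))
    (hs : 4 * s + 2 * dualType e s < p) (hs' : p < 4 * s + 4 + 2 * dualType e (s + 1 : ℤ)) :
    (u, w) ∈ S.imageStrip (dualType e) s := by
  rw [mem_imageStrip_iff hg he.dual]
  have hq' := hq.shift hg 1
  rw [mul_one] at hq'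
  refine ⟨p, _, hp, hq', hs.le, hs'.le, ?_⟩
  have b1 := he.dual.bounds (s : Index g)
  have b2 := he.dual.bounds (s + 1 : ℤ)
  have b3 := he.bounds (j : ℤ)
  have b4 := he.bounds (j + 1 : ℤ)
  have f1 : (j - s) % 4 = 2 → e j = 1 - dualType e s := dualType_of_mod he
  have f2 : (j - (s + 1)) % 4 = 2 → e j = 1 - dualType e (s + 1 : ℤ) := dualType_of_mod he
  have f3 : (j + 1 - (s + 1)) % 4 = 2 → e (j + 1 : ℤ) = 1 - dualType e (s + 1 : ℤ) :=
    dualType_of_mod he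
  have f4 : (j + 1 - s) % 4 = 2 → e (j + 1 : ℤ) = 1 - dualType e s := dualType_of_mod he
  generalize e (j : ℤ) = E0 at *
  generalize e (j + 1 : ℤ) = E1 at *
  generalize dualType e (s : ℤ) = D0 at *
  generalize dualType e (s + 1 : ℤ) = D1 at *
  omega

/-- Over a point of `D` two vertical strips meet, and neither need contain the whole fibre of the
domain; together they cover it. -/
theorem mem_imageStrip_of_loc_eq (hg : 2 ≤ g) {e : Index g → ℤ} (he : IsType e) {u w : Circle}
    {j p q s : ℤ} (hp : S.Loc u p) (hq : S.Loc w q) (h1 : 4 * j + 10 - 4 * e j ≤ p)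
    (h2 : 4 * j ≤ q) (h3 : q < 4 * j + 4)
    (h4 : (q < 4 * j + 2 ∧ p ≤ 4 * j - 4 - 4 * e j + 4 * (8 * g - 4)) ∨
        (4 * j + 2 ≤ q ∧ p ≤ 4 * j - 4 * e (j + 1 : ℤ) + 4 * (8 * g - 4)))
    (hs : p = 4 * s + 2 * dualType e s) :
    (u, w) ∈ S.imageStrip (dualType e) s ∨ (u, w) ∈ S.imageStrip (dualType e) (s - 1 : ℤ) := by
  rw [mem_imageStrip_iff hg he.dual, mem_imageStrip_iff hg he.dual]
  have hq' := hq.shift hg 1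
  rw [mul_one] at hq'
  have b0 := he.dual.bounds (s - 1 : ℤ)
  have b1 := he.dual.bounds (s : Index g)
  have b2 := he.dual.bounds (s + 1 : ℤ)
  have b3 := he.bounds (j : ℤ)
  have b4 := he.bounds (j + 1 : ℤ)
  obtain ⟨f1, f2, f3, f4, f5, f6, f7⟩ := he.corners j s
  rw [sub_add_cancel]
  suffices h :
      (((4 * s + 10 ≤ q + 4 * (8 * g - 4) ∧ q < 4 * s - 4) ∨
        (dualType e s = 1 ∧ 4 * s + 6 ≤ q + 4 * (8 * g - 4) ∧ q + 4 * (8 * g - 4) < 4 * s + 10) ∨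
        (dualType e (s + 1 : ℤ) = 0 ∧ 4 * s - 4 ≤ q ∧ q < 4 * s ∧ 4 * s + 2 ≤ p))) ∨
      (((4 * s + 6 ≤ q + 4 * (8 * g - 4) ∧ q < 4 * s - 8) ∨
        (dualType e (s - 1 : ℤ) = 1 ∧ 4 * s + 2 ≤ q + 4 * (8 * g - 4) ∧
          q + 4 * (8 * g - 4) < 4 * s + 6 ∧ p ≤ 4 * s) ∨
        (dualType e s = 0 ∧ 4 * s - 8 ≤ q ∧ q < 4 * s - 4))) by
    rcases h with h | h
    · exact Or.inl ⟨p, _, hp, hq', by omega, by omega, by omega⟩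
    · exact Or.inr ⟨p, _, hp, hq', by omega, by omega, by omega⟩
  generalize e (j : ℤ) = E0 at *
  generalize e (j + 1 : ℤ) = E1 at *
  generalize dualType e (s : ℤ) = D0 at *
  generalize dualType e (s + 1 : ℤ) = D1 at *
  generalize dualType e (s - 1 : ℤ) = D2 at *
  by_cases c1 : 4 * s + 10 ≤ q + 4 * (8 * g - 4)
  · by_cases c2 : q < 4 * s - 4
    · exact Or.inl (Or.inl ⟨c1, c2⟩)
    · exact Or.inl (Or.inr (Or.inr ⟨by omega, by omega, by omega, by omega⟩))
  by_cases c3 : D0 = 1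
  · exact Or.inl (Or.inr (Or.inl ⟨c3, by omega, by omega⟩))
  by_cases c4 : 4 * s + 6 ≤ q + 4 * (8 * g - 4)
  · exact Or.inr (Or.inl ⟨c4, by omega⟩)
  · exact Or.inr (Or.inr (Or.inl ⟨by omega, by omega, by omega, by omega⟩))

theorem swap_mem_dom (hg : 2 ≤ g) {e : Index g → ℤ} (he : IsType e) {u w : Circle}
    (h : (u, w) ∈ S.dom e) : (w, u) ∈ S.dom (dualType e) := by
  rw [mem_dom_iff hg he] at h
  obtain ⟨j, p, q, hp, hq, h1, h2, h3, h4⟩ := h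
  have hq' := hq.shift hg 1
  rw [mul_one] at hq'
  rw [mem_dom_iff hg he.dual]
  obtain ⟨m, hm⟩ : ∃ m, p / 4 = m := ⟨_, rfl⟩
  have b0 := he.dual.bounds (m - 1 : ℤ)
  have b1 := he.dual.bounds (m : Index g)
  have b2 := he.dual.bounds (m + 1 : ℤ)
  have b3 := he.bounds (j : ℤ)
  have b4 := he.bounds (j + 1 : ℤ)
  obtain ⟨f1, f2, f3, f4, f5, f6, f7⟩ := he.corners j m
  -- A mark shared by two cells is assigned to the cell of the form `[Q, P]`, because the section
  -- there contains the sections over both neighbouring cells `[P, Q]`.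
  by_cases c0 : p = 4 * m
  · refine ⟨m - 1, _, p, hq', hp, ?_, by omega, by omega, Or.inr ⟨by omega, ?_⟩⟩
    · omega
    · rw [sub_add_cancel]; omega
  by_cases c1 : p = 4 * m + 1
  · exact ⟨m, _, p, hq', hp, by omega, by omega, by omega, Or.inl ⟨by omega, by omega⟩⟩
  · exact ⟨m, _, p, hq', hp, by omega, by omega, by omega, Or.inr ⟨by omega, by omega⟩⟩

theorem swap_image_dom (hg : 2 ≤ g) {e : Index g → ℤ} (he : IsType e) :
    Prod.swap '' S.dom e = S.dom (dualType e) := by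
  ext ⟨u, w⟩
  rw [Set.image_swap_eq_preimage_swap]
  refine ⟨fun h => swap_mem_dom hg he h, fun h => ?_⟩
  have := swap_mem_dom hg he.dual h
  rwa [dualType_dualType he] at this

end SurfacePolygon

/-! ### Removing the upper horizontal edges -/

theorem ne_of_mem_arcCO {a b w : Circle} (hw : w ∈ arcCO a b) : w ≠ b := by
  rcases hw with ⟨rfl, h⟩ | h
  exacts [h, h.ne₂₃]

theorem mem_arcCO_trans {a b w y : Circle} (hw : w ∈ arcCO a b) (hy : y ∈ arcCO w b) :
    y ∈ arcCO a b := by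
  rcases hw with ⟨rfl, -⟩ | hw
  · exact hy
  rcases hy with ⟨rfl, -⟩ | hy
  · exact Or.inr hw
  · exact Or.inr (hw.rotate.rotate.trans hy.rotate.rotate).rotate

/-- Supplies a test point just above `w`, on the given segment and before the next mark. -/
theorem exists_ccw_mem_arcCO {a b w x : Circle} (hw : w ∈ arcCO a b) (hx : x ≠ w) :
    ∃ y ∈ arcCO w x, Ccw a y b := by
  have hwb := ne_of_mem_arcCO hw
  have key : ∀ y, Ccw w y b → Ccw a y b := by
    intro y hy
    rcases hw with ⟨rfl, -⟩ | hw
    · exact hy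
    · exact (hw.rotate.rotate.trans hy.rotate.rotate).rotate
  by_cases hxb : x = b
  · obtain ⟨y, hy⟩ := exists_ccw hwb
    exact ⟨y, Or.inr (hxb ▸ hy), key y hy⟩
  rcases ccw_or_ccw hx.symm hwb hxb with h | h
  · obtain ⟨y, hy⟩ := exists_ccw hx.symm
    exact ⟨y, Or.inr hy, key y (hy.trans h)⟩
  · obtain ⟨y, hy⟩ := exists_ccw hwb
    exact ⟨y, Or.inr (hy.trans h), key y hy⟩

namespace SurfacePolygon

variable {g : ℕ} {S : SurfacePolygon g}

theorem lowerPart_dom (hg : 2 ≤ g) {e : Index g → ℤ} (he : IsType e) :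
    lowerPart (S.dom e) = S.domCO e := by
  ext ⟨u, w⟩
  constructor
  · rintro ⟨-, x, hx, h⟩
    obtain ⟨q, hq⟩ := S.exists_loc hg w
    have hw := hq.mem_arcCO hg (a := q / 2) (b := q / 2 + 1) (by omega) (by omega) (by omega)
    obtain ⟨y, hy, hyc⟩ := exists_ccw_mem_arcCO hw hx
    have hyl : S.Loc y (2 * (q / 2) + 1) := Or.inr ⟨_, rfl, hyc⟩
    have hu := h y hy
    rw [mem_dom_iff hg he] at hu
    obtain ⟨j, p, q', hp, hq', h1, h2, h3, h4⟩ := hu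
    obtain ⟨t, ht⟩ := hyl.unique hg hq'
    -- The test point lies strictly between marks, so it cannot be on the upper edge of its cell;
    -- `w` then belongs to the half-open version of the same cell.
    have hodd : q' % 2 = 1 := by
      have : 4 * (8 * g - 4) * t = 2 * (2 * (8 * g - 4) * t) := by ring
      omega
    rw [mem_domCO_iff hg he]
    exact ⟨j, p, _, hp, hq.shift hg t, h1, by omega, by omega, by omega⟩
  · rintro ⟨i, ⟨hu, hw⟩ | ⟨hu, hw⟩⟩
    · exact ⟨⟨i, Or.inl ⟨hu, arcCO_subset_arc hw⟩⟩, _, (ne_of_mem_arcCO hw).symm, fun y hy =>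
        ⟨i, Or.inl ⟨hu, arcCO_subset_arc (mem_arcCO_trans hw hy)⟩⟩⟩
    · exact ⟨⟨i, Or.inr ⟨hu, arcCO_subset_arc hw⟩⟩, _, (ne_of_mem_arcCO hw).symm, fun y hy =>
        ⟨i, Or.inr ⟨hu, arcCO_subset_arc (mem_arcCO_trans hw hy)⟩⟩⟩

theorem finiteRectangular_dom (hg : 2 ≤ g) {e : Index g → ℤ} (he : IsType e) :
    FiniteRectangular (S.dom e) := by
  classical
  have : NeZero (8 * g - 4) := ⟨by omega⟩
  let f : Index g × Bool → (Circle × Circle) × (Circle × Circle) := fun i =>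
    bif i.2 then ((S.Q (i.1 + 2 - (e i.1 : Index g)), S.P (i.1 - 1 - (e i.1 : Index g))),
      (S.P i.1, S.Q i.1))
    else ((S.Q (i.1 + 2 - (e i.1 : Index g)), S.P (i.1 - (e (i.1 + 1) : Index g))),
      (S.Q i.1, S.P (i.1 + 1)))
  refine ⟨Finset.univ.image f, ⟨f (0, true), by simp⟩, ?_, ?_⟩
  · intro r hr
    obtain ⟨⟨i, b⟩, -, rfl⟩ := Finset.mem_image.1 hr
    obtain ⟨k, rfl⟩ := exists_intCast i
    have b1 := he.bounds (k : Index g)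
    have b2 := he.bounds ((k : Index g) + 1)
    have e1 : S.Q ((k : Index g) + 2 - (e k : Index g)) = S.mark (2 * (k + 2 - e k) + 1) := by
      rw [mark_Q]; push_cast; rfl
    have e2 : S.P ((k : Index g) - 1 - (e k : Index g)) =
        S.mark (2 * (k - 1 - e k) + 2 * (8 * g - 4)) := by
      rw [← mark_sub_period hg, mark_P]; push_cast; rfl
    have e3 : S.P ((k : Index g) - (e ((k : Index g) + 1) : Index g)) =
        S.mark (2 * (k - e ((k : Index g) + 1)) + 2 * (8 * g - 4)) := by
      rw [← mark_sub_period hg, mark_P]; push_cast; rfl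
    cases b <;> simp only [f, cond_true, cond_false] <;>
      simp only [e1, e2, e3, P_add_one, P_intCast, Q_intCast] <;>
      exact ⟨S.mark_ne hg (by omega) (by omega), S.mark_ne hg (by omega) (by omega)⟩
  · rw [Finset.set_biUnion_finset_image]
    ext p
    simp only [dom, Set.mem_ofPred_eq, Set.mem_iUnion, Finset.mem_univ, exists_prop, true_and,
      Prod.exists, Bool.exists_bool, f, cond_true, cond_false, Set.mem_prod, sectionPQ, sectionQP]
    exact exists_congr fun i => or_comm

/-! ### The natural extension on strips -/

theorem mem_param_arcCO_iff (hg : 2 ≤ g) {e : Index g → ℤ} (he : IsType e) {w : Circle} (k : ℤ) :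
    w ∈ arcCO (S.param e k) (S.param e (k + 1)) ↔
      ∃ q, S.Loc w q ∧ 4 * k + 2 * e k ≤ q ∧ q < 4 * k + 4 + 2 * e (k + 1 : ℤ) := by
  have b1 := he.bounds (k : Index g)
  have b2 := he.bounds (k + 1 : ℤ)
  have e2 : S.param e ((k : Index g) + 1) = S.param e (k + 1 : ℤ) := by push_cast; rfl
  rw [e2, param_intCast he, param_intCast he, mem_arcCO_iff hg (by omega) (by omega)]
  refine exists_congr fun p => and_congr_right fun _ => ?_
  omega

theorem exists_mem_param_arcCO (hg : 2 ≤ g) {e : Index g → ℤ} (he : IsType e) (w : Circle) :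
    ∃ i, w ∈ arcCO (S.param e i) (S.param e (i + 1)) := by
  obtain ⟨q, hq⟩ := S.exists_loc hg w
  have b1 := he.bounds (q / 4 : ℤ)
  have b2 := he.bounds (q / 4 - 1 : ℤ)
  have b3 := he.bounds (q / 4 + 1 : ℤ)
  by_cases h : 4 * (q / 4) + 2 * e (q / 4 : ℤ) ≤ q
  · exact ⟨(q / 4 : ℤ), (mem_param_arcCO_iff hg he _).2 ⟨q, hq, h, by omega⟩⟩
  · refine ⟨(q / 4 - 1 : ℤ), (mem_param_arcCO_iff hg he _).2 ⟨q, hq, by omega, ?_⟩⟩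
    rw [sub_add_cancel]; omega

theorem intCast_add_period (hg : 2 ≤ g) (k t : ℤ) :
    ((k + (8 * g - 4) * t : ℤ) : Index g) = k :=
  intCast_eq_of_dvd hg ⟨-t, by ring⟩

theorem param_arcCO_unique (hg : 2 ≤ g) {e : Index g → ℤ} (he : IsType e) {w : Circle}
    {i i' : Index g} (h : w ∈ arcCO (S.param e i) (S.param e (i + 1)))
    (h' : w ∈ arcCO (S.param e i') (S.param e (i' + 1))) : i = i' := by
  obtain ⟨k, rfl⟩ := exists_intCast i
  obtain ⟨k', rfl⟩ := exists_intCast i'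
  rw [mem_param_arcCO_iff hg he] at h h'
  obtain ⟨q, hq, h1, h2⟩ := h
  obtain ⟨q', hq', h1', h2'⟩ := h'
  obtain ⟨t, rfl⟩ := hq.unique hg hq'
  have e1 : ((k + (8 * g - 4) * t : ℤ) : Index g) = k := intCast_add_period hg k t
  have e2 : ((k + (8 * g - 4) * t + 1 : ℤ) : Index g) = (k + 1 : ℤ) := by
    rw [add_right_comm]; exact intCast_add_period hg _ t
  rw [← e1]
  rw [← e1] at h1
  rw [← e2] at h2
  obtain ⟨m, hm⟩ : ∃ m, k + (8 * g - 4) * t = m := ⟨_, rfl⟩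
  have hm' : 4 * (8 * g - 4) * t = 4 * (m - k) := by rw [← hm]; ring
  rw [hm] at h1 h2 ⊢
  have b1 := he.bounds (m : Index g)
  have b2 := he.bounds (m + 1 : ℤ)
  have b3 := he.bounds (k' : Index g)
  have b4 := he.bounds (k' + 1 : ℤ)
  rcases lt_trichotomy m k' with hlt | rfl | hlt
  · exfalso
    by_cases h3 : k' = m + 1
    · subst h3; omega
    · omega
  · rfl
  · exfalso
    by_cases h3 : m = k' + 1
    · subst h3; omega
    · omega

/-- The arcs `[A i, A (i+1))` partition the circle, so the choice in `label` has no freedom. -/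
theorem label_eq (hg : 2 ≤ g) {e : Index g → ℤ} (he : IsType e) {w : Circle}
    {i : Index g} (h : w ∈ arcCO (S.param e i) (S.param e (i + 1))) :
    label (S.param e) w = i :=
  param_arcCO_unique hg he (Classical.epsilon_spec (p := fun i => w ∈ arcCO (S.param e i)
    (S.param e (i + 1))) ⟨i, h⟩) h

theorem F_eq (hg : 2 ≤ g) {e : Index g → ℤ} (he : IsType e) {p : Circle × Circle}
    {i : Index g} (h : p.2 ∈ arcCO (S.param e i) (S.param e (i + 1))) :
    S.F (S.param e) p = (S.T i • p.1, S.T i • p.2) := by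
  rw [F, label_eq hg he h]

theorem mem_strip_of_mem_domCO (hg : 2 ≤ g) {e : Index g → ℤ} (he : IsType e)
    {p : Circle × Circle} {i : Index g} (hp : p ∈ S.domCO e)
    (h : p.2 ∈ arcCO (S.param e i) (S.param e (i + 1))) : p ∈ S.strip e i := by
  obtain ⟨u, w⟩ := p
  obtain ⟨k, rfl⟩ := exists_intCast i
  rw [mem_param_arcCO_iff hg he] at h
  rw [mem_domCO_iff hg he] at hp
  obtain ⟨q', hq', h5, h6⟩ := h
  obtain ⟨j, p, q, hp, hq, h1, h2, h3, h4⟩ := hp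
  obtain ⟨t, rfl⟩ := hq.unique hg hq'
  have e1 : ((j + (8 * g - 4) * t : ℤ) : Index g) = j := intCast_add_period hg j t
  have e2 : ((j + (8 * g - 4) * t + 1 : ℤ) : Index g) = (j + 1 : ℤ) := by
    rw [add_right_comm]; exact intCast_add_period hg _ t
  rw [← e1] at h1 h4
  rw [← e2] at h4
  obtain ⟨m, hm⟩ : ∃ m, j + (8 * g - 4) * t = m := ⟨_, rfl⟩
  have hm' : 4 * (8 * g - 4) * t = 4 * (m - j) := by rw [← hm]; ring
  rw [hm] at h1 h4
  have b1 := he.bounds (m : Index g)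
  have b2 := he.bounds (m + 1 : ℤ)
  have b3 := he.bounds (k : Index g)
  have b4 := he.bounds (k + 1 : ℤ)
  rw [mem_strip_iff hg he]
  refine ⟨p + 4 * (8 * g - 4) * t, _, hp.shift hg t, hq', ?_⟩
  -- The arc `[A k, A (k+1))` reaches into the cell of `P (k+1)` when `A (k+1) = Q (k+1)`.
  obtain rfl | rfl : m = k ∨ m = k + 1 := by omega
  · omega
  · omega

theorem strip_subset (hg : 2 ≤ g) {e : Index g → ℤ} (he : IsType e) (i : Index g) :
    S.strip e i ⊆ S.domCO e ∩ {p | p.2 ∈ arcCO (S.param e i) (S.param e (i + 1))} := by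
  rintro ⟨u, w⟩ h
  refine ⟨?_, ?_⟩
  · rcases h with ⟨-, h⟩ | h | ⟨-, h⟩
    exacts [⟨i, Or.inl h⟩, ⟨i, Or.inr h⟩, ⟨i + 1, Or.inl h⟩]
  · obtain ⟨k, rfl⟩ := exists_intCast i
    rw [mem_strip_iff hg he] at h
    obtain ⟨p, q, -, hq, h1, h2⟩ := h
    have b3 := he.bounds (k : Index g)
    have b4 := he.bounds (k + 1 : ℤ)
    exact (mem_param_arcCO_iff hg he k).2 ⟨q, hq, by omega, by omega⟩

theorem dualType_sigma (hg : 2 ≤ g) {e : Index g → ℤ} (he : IsType e) (i : Index g) :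
    dualType e (sigma i) = 1 - e i := by
  rw [dualType, ← sigma_sub_two hg, he.sigma hg, sub_add_cancel]

theorem dualType_sigma_add_one (hg : 2 ≤ g) {e : Index g → ℤ} (he : IsType e) (i : Index g) :
    dualType e (sigma i + 1) = 1 - e (i + 1) := by
  obtain ⟨k, rfl⟩ := exists_intCast i
  rw [dualType]
  congr 1
  by_cases hk : Even k
  · rw [sigma_even hg hk]
    have := he.eq_of_mod (a := k + 1) (b := 2 - k + 1 + 2) (by grind)
    push_cast at this ⊢
    exact this
  · rw [sigma_odd hg hk]
    have := he.eq_of_mod (a := k + 1) (b := 4 * g - k + 1 + 2) (by grind)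
    push_cast at this ⊢
    exact this

/-- The side pairings map the horizontal strips to the vertical strips. -/
theorem smul_mem_imageStrip (hg : 2 ≤ g) {e : Index g → ℤ} (he : IsType e) (i : Index g)
    {u w : Circle} :
    (S.T i • u, S.T i • w) ∈ S.imageStrip (dualType e) (sigma i) ↔ (u, w) ∈ S.strip e i := by
  have h0 := dualType_sigma hg he i
  have h1 := dualType_sigma_add_one hg he i
  -- The ends of the section over `[Q i, P (i+1)]` go to two consecutive points of `D`, so this
  -- rectangle becomes the full-width one. The optional pieces over `[P i, Q i)` and `[P (i+1), Q
  -- (i+1))` become the two narrower ones.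
  have a0 : S.param (dualType e) (sigma i) = S.T i • S.Q (i + 2 - (e i : Index g)) := by
    rcases he.zero_or_one i with h | h
    · rw [param, h0, h, if_neg (by norm_num), Int.cast_zero, sub_zero, S.T_Q_succ_succ hg]
    · rw [param, h0, h, if_pos (by norm_num), Int.cast_one, ← S.T_Q_succ hg]
      congr 2; ring
  have a1 : S.param (dualType e) (sigma i + 1) = S.T i • S.P (i - (e (i + 1) : Index g)) := by
    rcases he.zero_or_one (i + 1) with h | h
    · rw [param, h1, h, if_neg (by norm_num), Int.cast_zero, sub_zero, S.T_P hg]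
    · rw [param, h1, h, if_pos (by norm_num), Int.cast_one, S.T_P_pred hg]
  have c0 : 1 - e i = 1 ↔ e i = 0 := by omega
  have c1 : 1 - e (i + 1) = 0 ↔ e (i + 1) = 1 := by omega
  have d0 : e i = 0 → S.sectionPQ e i = arc (S.Q (i + 2)) (S.P (i - 1)) := by
    intro h; rw [sectionPQ, h, Int.cast_zero, sub_zero, sub_zero]
  have d1 : e (i + 1) = 1 → S.sectionPQ e (i + 1) = arc (S.Q (i + 2)) (S.P (i - 1)) := by
    intro h; rw [sectionPQ, h, Int.cast_one]; congr 2 <;> ring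
  simp only [imageStrip, strip, Set.mem_ofPred_eq]
  rw [h0, h1, a0, a1, c0, c1, ← S.T_Q_succ_succ hg i, ← S.T_P_pred hg i, ← S.T_P hg i,
    ← S.T_Q hg i, ← S.T_P_succ hg i, ← S.T_Q_succ hg i]
  simp only [smul_mem_arc, smul_mem_arcCO]
  rw [← sectionQP]
  constructor
  · rintro (h | ⟨h, h'⟩ | ⟨h, h'⟩)
    · exact Or.inr (Or.inl h)
    · exact Or.inl ⟨h, by rwa [d0 h]⟩
    · exact Or.inr (Or.inr ⟨h, by rwa [d1 h]⟩)
  · rintro (⟨h, h'⟩ | h | ⟨h, h'⟩)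
    · exact Or.inr (Or.inl ⟨h, by rwa [d0 h] at h'⟩)
    · exact Or.inl h
    · exact Or.inr (Or.inr ⟨h, by rwa [d1 h] at h'⟩)

theorem exists_mem_imageStrip (hg : 2 ≤ g) {e : Index g → ℤ} (he : IsType e)
    {p : Circle × Circle} (hp : p ∈ S.domCO e) : ∃ s, p ∈ S.imageStrip (dualType e) s := by
  obtain ⟨u, w⟩ := p
  rw [mem_domCO_iff hg he] at hp
  obtain ⟨j, p, q, hp, hq, h1, h2, h3, h4⟩ := hp
  have hd := he.dual
  have b1 := hd.bounds (p / 4 : ℤ)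
  have b2 := hd.bounds (p / 4 - 1 : ℤ)
  have b3 := hd.bounds (p / 4 + 1 : ℤ)
  rcases lt_trichotomy (4 * (p / 4) + 2 * dualType e (p / 4 : ℤ)) p with h | h | h
  · exact ⟨_, mem_imageStrip_of_loc hg he hp hq h1 h2 h3 h4 h (by omega)⟩
  · rcases mem_imageStrip_of_loc_eq hg he hp hq h1 h2 h3 h4 h.symm with h | h
    exacts [⟨_, h⟩, ⟨_, h⟩]
  · refine ⟨_, mem_imageStrip_of_loc hg he (s := p / 4 - 1) hp hq h1 h2 h3 h4 (by omega) ?_⟩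
    rw [sub_add_cancel]; omega

/-- Over the interior of `[D s, D (s+1)]`, the domain is the vertical strip. -/
theorem mem_imageStrip_of_mem_domCO (hg : 2 ≤ g) {e : Index g → ℤ} (he : IsType e)
    {p : Circle × Circle} (hp : p ∈ S.domCO e) {s : Index g}
    (h : p.1 ∈ arcCO (S.param (dualType e) s) (S.param (dualType e) (s + 1)))
    (h' : p.1 ≠ S.param (dualType e) s) : p ∈ S.imageStrip (dualType e) s := by
  obtain ⟨u, w⟩ := p
  obtain ⟨k, rfl⟩ := exists_intCast s
  have hd := he.dual
  rw [mem_param_arcCO_iff hg hd] at h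
  rw [mem_domCO_iff hg he] at hp
  obtain ⟨p', hp', h5, h6⟩ := h
  obtain ⟨j, p, q, hp, hq, h1, h2, h3, h4⟩ := hp
  obtain ⟨t, rfl⟩ := hp'.unique hg hp
  have e1 : ((k + (8 * g - 4) * t : ℤ) : Index g) = k := intCast_add_period hg k t
  have e2 : ((k + (8 * g - 4) * t + 1 : ℤ) : Index g) = (k + 1 : ℤ) := by
    rw [add_right_comm]; exact intCast_add_period hg _ t
  have h7 : p' ≠ 4 * k + 2 * dualType e k := by
    rintro rfl
    apply h'
    change u = _
    rw [param_intCast hd]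
    rcases hp' with ⟨a, ha, rfl⟩ | ⟨a, ha, -⟩
    · congr 1; omega
    · omega
  rw [← e1]
  refine mem_imageStrip_of_loc hg he hp hq h1 h2 h3 h4 ?_ ?_
  · rw [e1, mul_add, ← mul_assoc]; omega
  · rw [e2, mul_add, ← mul_assoc]; omega

theorem mem_arc_of_mem_imageStrip (hg : 2 ≤ g) {d : Index g → ℤ} (hd : IsType d)
    {p : Circle × Circle} {s : Index g} (hp : p ∈ S.imageStrip d s) :
    p.1 ∈ arcCO (S.param d s) (S.param d (s + 1)) ∨ p.1 = S.param d (s + 1) := by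
  obtain ⟨u, w⟩ := p
  obtain ⟨k, rfl⟩ := exists_intCast s
  rw [mem_imageStrip_iff hg hd] at hp
  obtain ⟨p, q, hp, -, h1, h2, -⟩ := hp
  rcases h2.eq_or_lt with h | h
  · right
    have e2 : S.param d ((k : Index g) + 1) = S.param d (k + 1 : ℤ) := by push_cast; rfl
    change u = _
    rw [e2, param_intCast hd]
    rcases hp with ⟨a, ha, rfl⟩ | ⟨a, ha, -⟩
    · congr 1; omega
    · omega
  · exact Or.inl ((mem_param_arcCO_iff hg hd k).2 ⟨p, hp, h1, h⟩)

/-- Forwards, horizontal strips go to vertical strips inside the domain. Backwards, a point of the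
vertical strip `s` is the image of its translate by `T s`, which lies in the horizontal strip
`σ(s)`. -/
theorem image_domCO (hg : 2 ≤ g) {e : Index g → ℤ} (he : IsType e) :
    S.F (S.param e) '' S.domCO e = S.domCO e := by
  apply Set.Subset.antisymm
  · rintro _ ⟨p, hp, rfl⟩
    obtain ⟨i, hi⟩ := exists_mem_param_arcCO hg he p.2
    rw [F_eq hg he hi]
    exact imageStrip_subset hg he _
      ((smul_mem_imageStrip hg he i).2 (mem_strip_of_mem_domCO hg he hp hi))
  · intro p hp
    obtain ⟨s, hs⟩ := exists_mem_imageStrip hg he hp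
    have h := (smul_mem_imageStrip (S := S) hg he (sigma s) (u := S.T s • p.1) (w := S.T s • p.2))
    rw [T_T, T_T, sigma_sigma hg] at h
    obtain ⟨h1, h2⟩ := strip_subset hg he _ (h.1 hs)
    refine ⟨_, h1, ?_⟩
    rw [F_eq hg he h2]
    simp only [T_T]

/-- Off the lines over `D`, the first coordinate determines the vertical strip, hence the side
pairing that produced the point. -/
theorem eq_of_F_eq (hg : 2 ≤ g) {e : Index g → ℤ} (he : IsType e) {p q : Circle × Circle}
    (hq : q ∈ S.domCO e) (hF : S.F (S.param e) q = p)
    (hp : p.1 ∉ Set.range (S.param (dualType e))) {s : Index g}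
    (hs : p.1 ∈ arcCO (S.param (dualType e) s) (S.param (dualType e) (s + 1))) :
    q = (S.T s • p.1, S.T s • p.2) := by
  obtain ⟨i, hi⟩ := exists_mem_param_arcCO hg he q.2
  have h := (smul_mem_imageStrip hg he i).2 (mem_strip_of_mem_domCO hg he hq hi)
  rw [F_eq hg he hi] at hF
  rw [hF] at h
  have h2 := (mem_arc_of_mem_imageStrip hg he.dual h).resolve_right
    fun h => hp ⟨_, h.symm⟩
  obtain rfl := param_arcCO_unique hg he.dual hs h2
  rw [← hF]
  simp only [T_T]

theorem isDomain_dom (hg : 2 ≤ g) {e : Index g → ℤ} (he : IsType e) :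
    S.IsDomain (S.param e) (S.dom e) where
  finiteRectangular := finiteRectangular_dom hg he
  image_eq := by rw [lowerPart_dom hg he, image_domCO hg he]
  injOn := by
    have : NeZero (8 * g - 4) := ⟨by omega⟩
    refine ⟨Set.range (S.param (dualType e)), Set.finite_range _, ?_⟩
    rintro p ⟨hp, hp'⟩ q ⟨hq, hq'⟩ h
    rw [lowerPart_dom hg he] at hp hq
    obtain ⟨s, hs⟩ := exists_mem_param_arcCO hg he.dual (S.F (S.param e) p).1
    rw [eq_of_F_eq hg he hp rfl hp' hs, eq_of_F_eq hg he hq h.symm hp' hs]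

theorem isParameter_param (e : Index g → ℤ) : S.IsParameter (S.param e) := by
  intro i
  rw [param]
  split_ifs
  exacts [Or.inl rfl, Or.inr (Or.inl rfl)]

/-- The unique preimage is obtained by `T s`, with `s` the label of `u` with respect to `D`. This is
the generator that the map for `D` uses at the swapped point. -/
theorem isDual_dom (hg : 2 ≤ g) {e : Index g → ℤ} (he : IsType e) :
    S.IsDual (S.param e) (S.dom e) (S.param (dualType e)) (S.dom (dualType e)) where
  isParameter_left := isParameter_param e
  isParameter_right := isParameter_param _
  isDomain_left := isDomain_dom hg he
  isDomain_right := isDomain_dom hg he.dual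
  swap_image := swap_image_dom hg he
  swap_preimage := by
    intro p hp hu
    rw [lowerPart_dom hg he] at hp ⊢
    obtain ⟨s, hs⟩ := exists_mem_param_arcCO hg he.dual p.1
    have hs' := mem_imageStrip_of_mem_domCO hg he hp hs fun h => hu ⟨s, h.symm⟩
    have h := (smul_mem_imageStrip (S := S) hg he (sigma s) (u := S.T s • p.1) (w := S.T s • p.2))
    rw [T_T, T_T, sigma_sigma hg] at h
    obtain ⟨h1, h2⟩ := strip_subset hg he _ (h.1 hs')
    refine ⟨_, h1, ?_, fun q' hq' hF => eq_of_F_eq hg he hq' hF hu hs, ?_⟩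
    · rw [F_eq hg he h2]
      simp only [T_T]
    · rw [F_eq hg he.dual (p := p.swap) hs]
      rfl

/-! ### The solution of the system of equations -/

/-- The points `G i` for parameters of type `e`. -/
def sol (S : SurfacePolygon g) (e : Index g → ℤ) (i : Index g) : Circle :=
  S.P (i + 1 - (e (i + 2) : Index g))

theorem param_eq_P (hg : 2 ≤ g) {e : Index g → ℤ} (he : IsType e) {i : Index g} :
    S.param e i = S.P i ↔ e i = 0 := by
  obtain ⟨k, rfl⟩ := exists_intCast i
  have hne := S.mark_ne hg (a := 2 * k) (b := 2 * k + 1) (by omega) (by omega)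
  rw [mark_P, mark_Q] at hne
  rcases he.zero_or_one k with h | h <;> simp [param, h, hne.symm]

theorem param_eq_Q (hg : 2 ≤ g) {e : Index g → ℤ} (he : IsType e) {i : Index g} :
    S.param e i = S.Q i ↔ e i = 1 := by
  obtain ⟨k, rfl⟩ := exists_intCast i
  have hne := S.mark_ne hg (a := 2 * k) (b := 2 * k + 1) (by omega) (by omega)
  rw [mark_P, mark_Q] at hne
  rcases he.zero_or_one k with h | h <;> simp [param, h, hne]

theorem IsType.tau (hg : 2 ≤ g) {e : Index g → ℤ} (he : IsType e) (i : Index g) :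
    e (tau i) = e (i + 2) := by
  obtain ⟨k, rfl⟩ := exists_intCast i
  have := he.eq_of_mod (a := k + 2) (b := k + (4 * g - 2)) (by omega)
  rw [tau_eq hg]; push_cast at this ⊢; exact this

theorem IsType.tau_add_two (hg : 2 ≤ g) {e : Index g → ℤ} (he : IsType e) (i : Index g) :
    e (BowenSeries.tau i + 2) = e i := by
  obtain ⟨k, rfl⟩ := exists_intCast i
  have := he.eq_of_mod (a := k) (b := k + (4 * g - 2) + 2) (by omega)
  rw [tau_eq hg]; push_cast at this ⊢; exact this

/-- Both kinds of equation reduce to the image of `P (k-1)` under `T k`, for `k = i` and for `k =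
τ(i) + 1`. -/
theorem isSolution_sol (hg : 2 ≤ g) {e : Index g → ℤ} (he : IsType e) :
    S.IsSolution (S.param e) (S.sol e) where
  mem_arc i := by
    rcases he.zero_or_one (i + 2) with h | h
    · exact Or.inr (Or.inl (by rw [sol, h, Int.cast_zero, sub_zero]))
    · exact Or.inl (by rw [sol, h, Int.cast_one, add_sub_cancel_right])
  eq_of_P i h := by
    rw [param_eq_P hg he] at h
    rw [sol, sol, ← sigma_sub_two hg, he.sigma hg, sub_add_cancel, h, Int.cast_zero, sub_zero,
      sub_zero, ← S.T_P_pred hg]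
    congr 2; ring
  eq_of_Q i h := by
    rw [param_eq_Q hg he] at h
    have := S.T_P_pred hg (tau i + 1)
    rw [add_sub_cancel_right, sigma_tau_add_one hg, sub_add_cancel] at this
    rw [sol, sol, ← sigma_sub_two hg, he.sigma hg, sub_add_cancel, he.tau_add_two hg, h,
      Int.cast_one, add_sub_cancel_right, add_sub_cancel_right, this]

/-- `T c` takes `[Q (c+1), P c]` to `[P (c'-2), Q (c'-1)]`, which is strictly inside `[Q (c'+1), P
c']`; `T c'` does the same with the roles exchanged. The product therefore contracts the first arc
into its interior. -/
theorem fixed_unique (hg : 2 ≤ g) {c c' : Index g} (hc : sigma c = c' - 2)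
    (hc' : sigma c' = c - 2) {x y : Circle} (hx : x ∈ arc (S.Q (c + 1)) (S.P c))
    (hy : y ∈ arc (S.Q (c + 1)) (S.P c)) (hTx : S.T c' • S.T c • x = x)
    (hTy : S.T c' • S.T c • y = y) : x = y := by
  have order : ∀ c : Index g, Ccw (S.Q (c + 1)) (S.P (c - 2)) (S.Q (c - 1)) ∧
      Ccw (S.Q (c + 1)) (S.Q (c - 1)) (S.P c) := by
    intro c
    obtain ⟨k, rfl⟩ := exists_intCast c
    have e1 : S.Q ((k : Index g) + 1) = S.mark (2 * (k + 1) + 1) := by rw [mark_Q]; push_cast; rfl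
    have e2 : S.P ((k : Index g) - 2) = S.mark (2 * (k - 2) + 2 * (8 * g - 4)) := by
      rw [← mark_sub_period hg, mark_P]; push_cast; rfl
    have e3 : S.Q ((k : Index g) - 1) = S.mark (2 * (k - 1) + 1 + 2 * (8 * g - 4)) := by
      rw [← mark_sub_period hg, mark_Q]; push_cast; rfl
    have e4 : S.P (k : Index g) = S.mark (2 * k + 2 * (8 * g - 4)) := by
      rw [← mark_sub_period hg, mark_P]
    rw [e1, e2, e3, e4]
    exact ⟨S.mark_ccw hg (by omega) (by omega) (by omega),
      S.mark_ccw hg (by omega) (by omega) (by omega)⟩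
  obtain ⟨o1, o2⟩ := order c
  obtain ⟨o1', o2'⟩ := order c'
  have ha : S.T c • S.Q (c + 1) = S.P (c' - 2) := by rw [S.T_Q_succ hg, hc]
  have hb : S.T c • S.P c = S.Q (c' - 1) := by rw [S.T_P hg, hc]; congr 1; ring
  have ha' : S.T c' • S.Q (c' + 1) = S.P (c - 2) := by rw [S.T_Q_succ hg, hc']
  have hb' : S.T c' • S.P c' = S.Q (c - 1) := by rw [S.T_P hg, hc']; congr 1; ring
  rw [← ccw_smul (S.T c'), ha', ← ha, ← hb, ← mul_smul, ← mul_smul] at o1'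
  rw [← ccw_smul (S.T c'), ha', hb', ← hb, ← mul_smul] at o2'
  refine fixed_eq_of_contracting (M := S.T c' * S.T c) ?_ ?_ hx hy (by rwa [mul_smul])
    (by rwa [mul_smul])
  · exact (o1'.trans' (o2'.trans o1.rotate)).rotate.rotate
  · exact ((o2'.trans' o1.rotate).rotate.rotate).trans o2

/-- The bound on `G j` places it in the contracted arc for either choice, `c = j + 1` or `c = j +
2`, of the preceding uniqueness result. -/
theorem arc_P_subset (hg : 2 ≤ g) (j : Index g) :
    arc (S.P j) (S.P (j + 1)) ⊆ arc (S.Q (j + 1 + 1)) (S.P (j + 1)) ∩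
      arc (S.Q (j + 2 + 1)) (S.P (j + 2)) := by
  intro x hx
  obtain ⟨k, rfl⟩ := exists_intCast j
  have e1 : S.Q ((k : Index g) + 1 + 1) = S.mark (2 * (k + 2) + 1 - 2 * (8 * g - 4)) := by
    rw [mark_sub_period hg, sub_add_cancel, mark_Q]; push_cast; congr 1; ring
  have e2 : S.Q ((k : Index g) + 2 + 1) = S.mark (2 * (k + 3) + 1 - 2 * (8 * g - 4)) := by
    rw [mark_sub_period hg, sub_add_cancel, mark_Q]; push_cast; congr 1; ring
  have e3 : S.P ((k : Index g) + 2) = S.mark (2 * (k + 2)) := by rw [mark_P]; push_cast; rfl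
  rw [P_intCast, P_add_one, mem_arc_iff hg (by omega) (by omega)] at hx
  obtain ⟨p, hp, h1, h2⟩ := hx
  rw [e1, e2, e3, P_add_one]
  exact ⟨hp.mem_arc hg (by omega) (by omega) (by omega),
    hp.mem_arc hg (by omega) (by omega) (by omega)⟩

/-- The equations at `σ(j)` and `j + 2` are of the same kind and involve only `G j` and `G (σ(j) -
2)`. Eliminating the latter leaves a fixed point equation. -/
theorem IsSolution.fixed_P (hg : 2 ≤ g) {e : Index g → ℤ} (he : IsType e) {G : Index g → Circle}
    (hG : S.IsSolution (S.param e) G) {j : Index g} (h : e (j + 2) = 0) :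
    S.T (sigma j) • S.T (j + 2) • G j = G j := by
  have h1 := hG.eq_of_P (sigma j) ((param_eq_P hg he).2 (by rw [he.sigma hg, h]))
  have h2 := hG.eq_of_P (j + 2) ((param_eq_P hg he).2 h)
  rw [sigma_sigma hg] at h1
  rw [sigma_add_two hg, add_sub_cancel_right] at h2
  rw [← h2, ← h1]

/-- Here the equations at `σ(j)` and `τ(j)` are coupled, through `G j` and `G (τ(σ(j)))`. -/
theorem IsSolution.fixed_Q (hg : 2 ≤ g) {e : Index g → ℤ} (he : IsType e) {G : Index g → Circle}
    (hG : S.IsSolution (S.param e) G) {j : Index g} (h : e (j + 2) = 1) :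
    S.T (tau (sigma j) + 1) • S.T (j + 1) • G j = G j := by
  have h1 := hG.eq_of_Q (sigma j) ((param_eq_Q hg he).2 (by rw [he.sigma hg, h]))
  have h2 := hG.eq_of_Q (tau j) ((param_eq_Q hg he).2 (by rw [he.tau hg, h]))
  rw [sigma_sigma hg] at h1
  rw [sigma_tau hg, tau_tau hg] at h2
  rw [← h2, ← h1]

theorem IsSolution.eq_sol (hg : 2 ≤ g) {e : Index g → ℤ} (he : IsType e) {G : Index g → Circle}
    (hG : S.IsSolution (S.param e) G) : G = S.sol e := by
  funext j
  have hs := isSolution_sol (S := S) hg he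
  obtain ⟨x1, x2⟩ := arc_P_subset hg j (hG.mem_arc j)
  obtain ⟨y1, y2⟩ := arc_P_subset hg j (hs.mem_arc j)
  rcases he.zero_or_one (j + 2) with h | h
  · exact fixed_unique hg (sigma_add_two hg j) (by rw [sigma_sigma hg]; ring) x2 y2
      (hG.fixed_P hg he h) (hs.fixed_P hg he h)
  · refine fixed_unique hg ?_ ?_ x1 y1 (hG.fixed_Q hg he h) (hs.fixed_Q hg he h)
    · have := sigma_tau_add_one hg (tau j)
      rw [tau_tau hg, sigma_tau hg] at this
      rw [this]; ring
    · rw [sigma_tau_add_one hg, sigma_sigma hg]; ring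

theorem H_sol (hg : 2 ≤ g) {e : Index g → ℤ} (he : IsType e) (i : Index g) :
    S.H (S.sol e) (i + 1) = S.Q (i + 2 - (e i : Index g)) := by
  have ht : tau (i + 1) - 1 = tau i := by rw [tau, tau]; ring
  have hs : sigma (i + 1) = sigma (tau i) - 1 := by
    have := sigma_tau_add_one hg (tau i)
    rwa [tau_tau hg] at this
  rw [H, ht, sol, he.tau_add_two hg]
  rcases he.zero_or_one i with h | h
  · rw [h, Int.cast_zero, sub_zero, sub_zero, S.T_P_succ hg, ← hs, S.T_P hg, sigma_sigma hg]
    congr 1; ring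
  · rw [h, Int.cast_one, add_sub_cancel_right, S.T_P hg,
      show sigma (tau i) + 1 = sigma (i + 1) + 2 by rw [hs]; ring, S.T_Q_succ_succ hg,
      sigma_sigma hg]
    congr 1; ring

/-- One inclusion uses that every solution is `sol`, the other that `sol` is a solution. -/
theorem Ω_param (hg : 2 ≤ g) {e : Index g → ℤ} (he : IsType e) :
    S.Ω (S.param e) = S.dom e := by
  have h1 : ∀ i, S.sol e (i - 2) = S.P (i - 1 - (e i : Index g)) := by
    intro i; rw [sol, sub_add_cancel]; congr 1; ring
  have h2 : ∀ i, S.sol e (i - 1) = S.P (i - (e (i + 1) : Index g)) := by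
    intro i
    rw [sol, sub_add_cancel, show i - 1 + 2 = i + 1 by ring]
  ext p
  constructor
  · rintro ⟨G, hG, hp⟩
    obtain rfl := hG.eq_sol hg he
    simp only [h1, h2, H_sol hg he] at hp
    obtain ⟨i, hi⟩ := Set.mem_iUnion.1 hp
    exact ⟨i, hi⟩
  · rintro ⟨i, hi⟩
    refine ⟨_, isSolution_sol hg he, Set.mem_iUnion.2 ⟨i, ?_⟩⟩
    simp only [h1, h2, H_sol hg he]
    exact hi

/-! ### Parameters given by residues modulo four -/

theorem isDual_param (hg : 2 ≤ g) {e d : Index g → ℤ} (he : IsType e)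
    (hd : ∀ i, d i = 1 - e (i + 2)) {A D : Index g → Circle} (hA : ∀ i, A i = S.param e i)
    (hD : ∀ i, D i = S.param d i) : S.IsDual A (S.Ω A) D (S.Ω D) := by
  obtain rfl : d = dualType e := funext hd
  rw [funext hA, funext hD, Ω_param hg he, Ω_param hg he.dual]
  exact isDual_dom hg he

/-- Parameters that depend only on the label modulo four. -/
theorem isType_of_mod_four (hg : 2 ≤ g) {f : ℕ → ℤ} (hf : ∀ m, f m = 0 ∨ f m = 1) :
    IsType fun i : Index g => f (i.val % 4) where
  zero_or_one i := hf _
  add_four i := by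
    obtain ⟨k, rfl⟩ := exists_intCast i
    have h1 := val_emod_four hg k
    have h2 := val_emod_four hg (k + 4)
    push_cast at h2
    congr 1; omega

theorem val_add_two (hg : 2 ≤ g) (i : Index g) : (i + 2).val % 4 = (i.val + 2) % 4 := by
  obtain ⟨k, rfl⟩ := exists_intCast i
  have h1 := val_emod_four hg k
  have h2 := val_emod_four hg (k + 2)
  push_cast at h2
  omega

/-- Reduces duality to a comparison of `f` and `h` on four residues. -/
theorem isDual_of_mod_four (hg : 2 ≤ g) {f h : ℕ → ℤ} {A D : Index g → Circle}
    (hf : ∀ m, f m = 0 ∨ f m = 1) (hh : ∀ m < 4, h m = 1 - f ((m + 2) % 4))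
    (hA : ∀ i, A i = S.param (fun i => f (i.val % 4)) i)
    (hD : ∀ i, D i = S.param (fun i => h (i.val % 4)) i) : S.IsDual A (S.Ω A) D (S.Ω D) := by
  refine isDual_param hg (isType_of_mod_four hg hf) (fun i => ?_) hA hD
  rw [hh _ (Nat.mod_lt _ (by norm_num)), val_add_two hg]
  congr 2; omega

end SurfacePolygon
end BowenSeries

theorem mainTheorem10 (g : ℕ) (hg : 2 ≤ g) (S : BowenSeries.SurfacePolygon g) :
    (S.IsDual S.P (S.Ω S.P) S.Q (S.Ω S.Q) ∧ S.IsDual S.Q (S.Ω S.Q) S.P (S.Ω S.P)) ∧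
    (S.IsDual S.altPQ (S.Ω S.altPQ) S.altQP (S.Ω S.altQP) ∧
      S.IsDual S.altQP (S.Ω S.altQP) S.altPQ (S.Ω S.altPQ)) ∧
    S.IsDual S.pairsPQ (S.Ω S.pairsPQ) S.pairsPQ (S.Ω S.pairsPQ) ∧
    S.IsDual S.pairsQP (S.Ω S.pairsQP) S.pairsQP (S.Ω S.pairsQP) := by
  have hP : ∀ i, S.P i = S.param (fun _ => 0) i := fun i => by
    simp [BowenSeries.SurfacePolygon.param]
  have hQ : ∀ i, S.Q i = S.param (fun _ => 1) i := fun i => by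
    simp [BowenSeries.SurfacePolygon.param]
  -- The parity is read off from the residue modulo 4, to match the form in which types are
  -- supplied.
  have haPQ : ∀ i, S.altPQ i = S.param (fun i => if i.val % 4 % 2 = 1 then 0 else 1) i :=
    fun i => by
      by_cases h : i.val % 2 = 1 <;>
        simp [BowenSeries.SurfacePolygon.param, BowenSeries.SurfacePolygon.altPQ, Nat.odd_iff, h]
  have haQP : ∀ i, S.altQP i = S.param (fun i => if i.val % 4 % 2 = 1 then 1 else 0) i :=
    fun i => by
      by_cases h : i.val % 2 = 1 <;>
        simp [BowenSeries.SurfacePolygon.param, BowenSeries.SurfacePolygon.altQP, Nat.odd_iff, h]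
  have hpPQ : ∀ i, S.pairsPQ i =
      S.param (fun i => if i.val % 4 = 1 ∨ i.val % 4 = 2 then 0 else 1) i := fun i => by
    by_cases h : i.val % 4 = 1 ∨ i.val % 4 = 2 <;>
      simp only [BowenSeries.SurfacePolygon.param, BowenSeries.SurfacePolygon.pairsPQ, h, if_true,
        if_false, one_ne_zero]
  have hpQP : ∀ i, S.pairsQP i =
      S.param (fun i => if i.val % 4 = 1 ∨ i.val % 4 = 2 then 1 else 0) i := fun i => by
    by_cases h : i.val % 4 = 1 ∨ i.val % 4 = 2 <;>
      simp only [BowenSeries.SurfacePolygon.param, BowenSeries.SurfacePolygon.pairsQP, h, if_true,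
        if_false, one_ne_zero]
  refine ⟨⟨?_, ?_⟩, ⟨?_, ?_⟩, ?_, ?_⟩
  · exact BowenSeries.SurfacePolygon.isDual_of_mod_four hg (f := fun _ => 0) (h := fun _ => 1)
      (by simp) (by simp) hP hQ
  · exact BowenSeries.SurfacePolygon.isDual_of_mod_four hg (f := fun _ => 1) (h := fun _ => 0)
      (by simp) (by simp) hQ hP
  · exact BowenSeries.SurfacePolygon.isDual_of_mod_four hg
      (f := fun m => if m % 2 = 1 then 0 else 1) (h := fun m => if m % 2 = 1 then 1 else 0)
      (fun m => by split_ifs <;> simp) (by decide) haPQ haQP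
  · exact BowenSeries.SurfacePolygon.isDual_of_mod_four hg
      (f := fun m => if m % 2 = 1 then 1 else 0) (h := fun m => if m % 2 = 1 then 0 else 1)
      (fun m => by split_ifs <;> simp) (by decide) haQP haPQ
  · exact BowenSeries.SurfacePolygon.isDual_of_mod_four hg
      (f := fun m => if m = 1 ∨ m = 2 then 0 else 1) (h := fun m => if m = 1 ∨ m = 2 then 0 else 1)
      (fun m => by split_ifs <;> simp) (by decide) hpPQ hpPQ
  · exact BowenSeries.SurfacePolygon.isDual_of_mod_four hg
      (f := fun m => if m = 1 ∨ m = 2 then 1 else 0) (h := fun m => if m = 1 ∨ m = 2 then 1 else 0)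
      (fun m => by split_ifs <;> simp) (by decide) hpQP hpQP
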